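/- Let $N\ge 0$ be an integer. Let $H_N$ be the rational Cherednik algebra associated with the symmetric group $S_N$: the unital associative $\mathbb C$-algebra with generators $x_i$, $y_i$ ($1\le i\le N$) and $s_{jk}$ ($1\le j,k\le N$, $j\ne k$) and relations $$s_{ij}=s_{ji},\quad s_{ij}^2=1,\quad s_{ij}s_{jk}=s_{ik}s_{ij},\quad s_{ij}s_{kl}=s_{kl}s_{ij},\quad [x_i,x_j]=[y_i,y_j]=0,$$ $$s_{ij}x_i=x_js_{ij},\quad s_{ij}y_i=y_js_{ij},\quad [s_{ij},x_k]=[s_{ij},y_k]=0,\quad [x_i,y_j]=s_{ij},\quad [x_i,y_i]=-\sum_{a\ne i}s_{ia},$$ where in each relation all the indices are distinct elements of $\{1,\dots,N\}$. A permutation $\sigma\in S_N$ is regarded as an element of $H_N$ through the unique group homomorphism from $S_N$ to the units of $H_N$ that sends each transposition $(i\,j)$ to $s_{ij}$. Let $(-1)^\sigma$ denote the sign of $\sigma$, let $\mathcal Z_N$ be the center of $H_N$, and put $e=\frac1{N!}\sum_{\sigma\in S_N}\sigma\in H_N$. The spherical subalgebra is $U_N=eH_Ne$, an algebra with identity element $e$.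 The normal ordering map is the linear map $\mathbb C[x_1,\dots,x_N]\otimes\mathbb C[S_N]\otimes\mathbb C[y_1,\dots,y_N]\to H_N$, $q\otimes\sigma\otimes p\mapsto q\,\sigma\,p$. For polynomials $f$ in the $x_i$, the $y_i$ and two further central variables $u,v$, the element $:\!f\!:\,\in H_N[u,v]$ is computed by expanding $f$ with the $x_i$ and $y_j$ treated as commuting variables and then applying the normal ordering map to each coefficient (so that all $x$'s are placed to the left of all $y$'s). Define $c_{ij}\in H_N$, $0\le i,j\le N$, by $$\mathcal P^{\mathcal Z}=(-1)^N\sum_{\sigma\in S_N}:\!\prod_{i,\ \sigma(i)=i}\bigl(1-(v-x_i)(u-y_i)\bigr)\!:\,(-1)^\sigma\sigma=\sum_{i,j=0}^N c_{ij}\,v^{N-i}u^{N-j}.$$ Let $X=\mathrm{diag}(x_1,\dots,x_N)$, $Y=\mathrm{diag}(y_1,\dots,y_N)$, let $K$ be the $N\times N$ matrix with all entries $1$, and let $\mathrm{rdet}\,A=\sum_{\sigma\in S_N}(-1)^\sigma a_{1\sigma(1)}a_{2\sigma(2)}\cdots a_{N\sigma(N)}$ be the row determinant. The universal spherical polynomial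 is $\mathcal P^U=\,:\!\mathrm{rdet}((v-X)(u-Y)-K)\!:\,e$. Theorem. One has $$\mathcal P^U=\sum_{i,j=0}^N (c_{ij}e)\,v^{N-i}u^{N-j},$$ the elements $c_{ij}e$ ($0\le i,j\le N$) belong to $U_N$, and they generate $U_N$ as a unital algebra with identity $e$. Moreover, the Satake homomorphism $\mathcal Z_N\to U_N=eH_Ne$, $c\mapsto ce$, is an isomorphism of algebras. -/

import Mathlib

/-! ### Extending a map from transpositions to the symmetric group -/

namespace Cherednik

open Equiv Polynomial
open scoped TensorProduct

section Symmetric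

theorem swap_mul_decomposeFin_succ {n : ℕ} (i j : Fin n) (p : Fin (n + 1)) (τ : Perm (Fin n)) :
    swap i.succ j.succ * Perm.decomposeFin.symm (p, τ) =
      Perm.decomposeFin.symm (swap i.succ j.succ p, swap i j * τ) := by
  have key : ∀ y : Fin n, (swap i j y).succ = swap i.succ j.succ y.succ := by
    intro y
    simp only [swap_apply_def, Fin.succ_inj]
    split_ifs <;> rfl
  ext x
  refine Fin.cases ?_ (fun y => ?_) x
  · simp
  · simp only [Perm.mul_apply, Perm.decomposeFin_symm_apply_succ, key]
    have h0 : swap i.succ j.succ 0 = 0 := swap_apply_of_ne_of_ne (Fin.succ_ne_zero i).symm (Fin.succ_ne_zero j).symm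
    have := swap_apply_apply (swap i.succ j.succ) 0 p
    rw [h0] at this
    rw [this]
    simp

theorem swap_zero_mul_decomposeFin {n : ℕ} (j k : Fin n) (h : k ≠ j) (τ : Perm (Fin n)) :
    swap 0 j.succ * Perm.decomposeFin.symm (k.succ, τ) =
      Perm.decomposeFin.symm (k.succ, swap k j * τ) := by
  have e : ∀ (p : Fin (n + 1)) (τ : Perm (Fin n)), Perm.decomposeFin.symm (p, τ) =
      swap 0 p * Perm.decomposeFin.symm (0, τ) := by
    intro p τ
    ext x
    refine Fin.cases ?_ (fun y => ?_) x <;> simp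
  have := swap_mul_decomposeFin_succ k j 0 τ
  rw [swap_apply_of_ne_of_ne (Fin.succ_ne_zero k).symm (Fin.succ_ne_zero j).symm] at this
  rw [e k.succ (swap k j * τ), ← this, e k.succ τ, ← mul_assoc, ← mul_assoc]
  congr 1
  have h2 := Equiv.mul_swap_eq_swap_mul (swap 0 k.succ) k.succ j.succ
  rw [h2]
  simp [swap_apply_of_ne_of_ne (Fin.succ_ne_zero j) (fun hh => h (Fin.succ_injective _ hh).symm)]

theorem exists_permHom_aux {M : Type*} [Monoid M] : ∀ (n : ℕ) (s : Fin n → Fin n → M),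
    (∀ i, s i i = 1) → (∀ i j, s i j * s i j = 1) →
    (∀ i j k l, s i j * s k l = s (swap i j k) (swap i j l) * s i j) → (∀ i j, s i j = s j i) →
    ∃ φ : Perm (Fin n) →* M, ∀ i j, φ (swap i j) = s i j
  | 0, s, _, _, _, _ => ⟨1, fun i => i.elim0⟩
  | n + 1, s, h1, h2, h3, h4 => by
    have key : ∀ i j y : Fin n, (swap i j y).succ = swap i.succ j.succ y.succ := by
      intro i j y
      simp only [swap_apply_def, Fin.succ_inj]
      split_ifs <;> rfl
    obtain ⟨φ, hφ⟩ := exists_permHom_aux n (fun i j => s i.succ j.succ) (fun i => h1 _)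
      (fun i j => h2 _ _) (fun i j k l => by simp only [key]; exact h3 _ _ _ _) (fun i j => h4 _ _)
    let f : Perm (Fin (n + 1)) → M := fun σ =>
      s 0 (Perm.decomposeFin σ).1 * φ (Perm.decomposeFin σ).2
    have hf : ∀ p τ, f (Perm.decomposeFin.symm (p, τ)) = s 0 p * φ τ := by
      intro p τ; simp [f]
    have f1 : f 1 = 1 := by
      have : (1 : Perm (Fin (n + 1))) = Perm.decomposeFin.symm (0, 1) := by simp [Perm.one_def]
      rw [this, hf, h1, map_one, one_mul]
    have fz : ∀ (j : Fin n) σ, f (swap 0 j.succ * σ) = s 0 j.succ * f σ := by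
      intro j σ
      obtain ⟨⟨p, τ⟩, rfl⟩ := Perm.decomposeFin.symm.surjective σ
      refine Fin.cases ?_ (fun k => ?_) p
      · have : swap 0 j.succ * Perm.decomposeFin.symm (0, τ) =
            Perm.decomposeFin.symm (j.succ, τ) := by
          ext x
          refine Fin.cases ?_ (fun y => ?_) x <;> simp
        rw [this, hf, hf, h1, one_mul]
      · by_cases hk : k = j
        · subst hk
          have : swap 0 k.succ * Perm.decomposeFin.symm (k.succ, τ) =
              Perm.decomposeFin.symm (0, τ) := by
            ext x
            refine Fin.cases ?_ (fun y => ?_) x <;> simp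
          rw [this, hf, hf, h1, one_mul, ← mul_assoc, h2, one_mul]
        · rw [swap_zero_mul_decomposeFin j k hk, hf, hf, map_mul, hφ, ← mul_assoc, ← mul_assoc,
            h3 0 k.succ k.succ j.succ]
          simp [swap_apply_of_ne_of_ne (Fin.succ_ne_zero j)
            (fun hh => hk (Fin.succ_injective _ hh).symm)]
    have fs : ∀ i j σ, f (swap i j * σ) = s i j * f σ := by
      intro i j
      refine Fin.cases (fun σ => ?_) (fun i σ => ?_) i
      · refine Fin.cases ?_ (fun j => ?_) j
        · rw [h1, swap_self]; simp [← Perm.one_def]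
        · exact fz j σ
      · refine Fin.cases ?_ (fun j => ?_) j
        · rw [swap_comm, h4]; exact fz i σ
        · obtain ⟨⟨p, τ⟩, rfl⟩ := Perm.decomposeFin.symm.surjective σ
          have h0 : swap i.succ j.succ 0 = 0 :=
            swap_apply_of_ne_of_ne (Fin.succ_ne_zero i).symm (Fin.succ_ne_zero j).symm
          rw [swap_mul_decomposeFin_succ, hf, hf, map_mul, hφ, ← mul_assoc, ← mul_assoc,
            h3 i.succ j.succ 0 p, h0]
    refine ⟨{ toFun := f, map_one' := f1, map_mul' := fun σ τ => ?_ }, fun i j => ?_⟩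
    · refine Perm.swap_induction_on σ ?_ (fun g x y _ ih => ?_)
      · rw [one_mul, f1, one_mul]
      · rw [mul_assoc, fs, fs, ih, ← mul_assoc]
    · have := fs i j 1
      rwa [mul_one, f1, mul_one] at this

end Symmetric

/-! ### The rational Cherednik algebra of the symmetric group -/

/-- The generators `x i`, `y i` and `s j k` (`j ≠ k`) of the rational Cherednik algebra. -/
inductive Gen (N : ℕ) : Type
  | x (i : Fin N) : Gen N
  | y (i : Fin N) : Gen N
  | s (j k : Fin N) (h : j ≠ k) : Gen N

section FreeGenerators

variable {N : ℕ}

/-- The generator `x i` in the free algebra. -/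
def fx (i : Fin N) : FreeAlgebra ℂ (Gen N) := FreeAlgebra.ι ℂ (Gen.x i)

/-- The generator `y i` in the free algebra. -/
def fy (i : Fin N) : FreeAlgebra ℂ (Gen N) := FreeAlgebra.ι ℂ (Gen.y i)

/-- The generator `s j k` in the free algebra. -/
def fs (j k : Fin N) (h : j ≠ k) : FreeAlgebra ℂ (Gen N) := FreeAlgebra.ι ℂ (Gen.s j k h)

end FreeGenerators

/-- The defining relations of the rational Cherednik algebra. In each relation the indices
are pairwise distinct. -/
inductive Rel (N : ℕ) : FreeAlgebra ℂ (Gen N) → FreeAlgebra ℂ (Gen N) → Prop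
  | s_symm (i j : Fin N) (h : i ≠ j) : Rel N (fs i j h) (fs j i h.symm)
  | s_sq (i j : Fin N) (h : i ≠ j) : Rel N (fs i j h ^ 2) 1
  | s_braid (i j k : Fin N) (hij : i ≠ j) (hjk : j ≠ k) (hik : i ≠ k) :
      Rel N (fs i j hij * fs j k hjk) (fs i k hik * fs i j hij)
  | s_comm (i j k l : Fin N) (hij : i ≠ j) (hkl : k ≠ l) (hik : i ≠ k) (hil : i ≠ l)
      (hjk : j ≠ k) (hjl : j ≠ l) :
      Rel N (fs i j hij * fs k l hkl) (fs k l hkl * fs i j hij)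
  | x_comm (i j : Fin N) (h : i ≠ j) : Rel N (fx i * fx j) (fx j * fx i)
  | y_comm (i j : Fin N) (h : i ≠ j) : Rel N (fy i * fy j) (fy j * fy i)
  | s_x (i j : Fin N) (h : i ≠ j) : Rel N (fs i j h * fx i) (fx j * fs i j h)
  | s_y (i j : Fin N) (h : i ≠ j) : Rel N (fs i j h * fy i) (fy j * fs i j h)
  | s_x_comm (i j k : Fin N) (h : i ≠ j) (hik : i ≠ k) (hjk : j ≠ k) :
      Rel N (fs i j h * fx k) (fx k * fs i j h)
  | s_y_comm (i j k : Fin N) (h : i ≠ j) (hik : i ≠ k) (hjk : j ≠ k) :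
      Rel N (fs i j h * fy k) (fy k * fs i j h)
  | xy (i j : Fin N) (h : i ≠ j) : Rel N (fx i * fy j - fy j * fx i) (fs i j h)
  | xy_self (i : Fin N) : Rel N (fx i * fy i - fy i * fx i)
      (-∑ a : {a : Fin N // a ≠ i}, fs i a.1 a.2.symm)

/-- The rational Cherednik algebra `H_N` associated with the symmetric group `S_N`. -/
def H (N : ℕ) : Type := RingQuot (Rel N)

noncomputable instance ringH (N : ℕ) : Ring (H N) := inferInstanceAs (Ring (RingQuot (Rel N)))

noncomputable instance algebraH (N : ℕ) : Algebra ℂ (H N) :=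
  inferInstanceAs (Algebra ℂ (RingQuot (Rel N)))

/-- The quotient map from the free algebra to `H_N`. -/
noncomputable def mk (N : ℕ) : FreeAlgebra ℂ (Gen N) →ₐ[ℂ] H N := RingQuot.mkAlgHom ℂ (Rel N)

theorem mk_rel {N : ℕ} {a b : FreeAlgebra ℂ (Gen N)} (h : Rel N a b) : mk N a = mk N b :=
  RingQuot.mkAlgHom_rel ℂ h

section Elements

variable {N : ℕ}

/-- The element `x i` of `H_N`. -/
noncomputable def x (i : Fin N) : H N := mk N (fx i)

/-- The element `y i` of `H_N`. -/
noncomputable def y (i : Fin N) : H N := mk N (fy i)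

/-- The element `s j k` of `H_N`. -/
noncomputable def s (j k : Fin N) (h : j ≠ k) : H N := mk N (fs j k h)

theorem s_symm (i j : Fin N) (h : i ≠ j) : s i j h = s j i h.symm :=
  mk_rel (Rel.s_symm i j h)

theorem s_mul_self (i j : Fin N) (h : i ≠ j) : s i j h * s i j h = 1 := by
  have := mk_rel (Rel.s_sq i j h)
  rwa [map_pow, map_one, pow_two] at this

theorem s_braid (i j k : Fin N) (hij : i ≠ j) (hjk : j ≠ k) (hik : i ≠ k) :
    s i j hij * s j k hjk = s i k hik * s i j hij := by
  have := mk_rel (Rel.s_braid i j k hij hjk hik)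
  rwa [map_mul, map_mul] at this

theorem s_comm (i j k l : Fin N) (hij : i ≠ j) (hkl : k ≠ l) (hik : i ≠ k) (hil : i ≠ l)
    (hjk : j ≠ k) (hjl : j ≠ l) : s i j hij * s k l hkl = s k l hkl * s i j hij := by
  have := mk_rel (Rel.s_comm i j k l hij hkl hik hil hjk hjl)
  rwa [map_mul, map_mul] at this

end Elements

theorem exists_permHom (N : ℕ) :
    ∃ φ : Perm (Fin N) →* H N, ∀ (i j : Fin N) (h : i ≠ j), φ (swap i j) = s i j h := by
  obtain ⟨φ, hφ⟩ := exists_permHom_aux N (fun i j => if h : i ≠ j then s i j h else (1 : H N))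
    (by simp)
    (by
      intro i j
      by_cases h : i = j
      · simp [h]
      · simp [h, s_mul_self])
    (by
      intro i j k l
      by_cases hij : i = j
      · subst hij; simp
      by_cases hkl : k = l
      · subst hkl; simp
      have hkl' : swap i j k ≠ swap i j l := fun hh => hkl ((swap i j).injective hh)
      simp only [ne_eq, hij, hkl, hkl', not_false_eq_true, dite_true]
      by_cases hik : i = k
      · subst hik
        by_cases hjl : j = l
        · subst hjl
          simp only [swap_apply_left, swap_apply_right]
          rw [s_symm j i]
        · simp only [swap_apply_left, swap_apply_of_ne_of_ne (Ne.symm hkl) (Ne.symm hjl)]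
          rw [s_symm i j, s_braid j i l _ _ hjl]
      by_cases hjk : j = k
      · subst hjk
        by_cases hil : i = l
        · subst hil
          simp only [swap_apply_left, swap_apply_right]
          rw [s_symm j i]
        · simp only [swap_apply_right, swap_apply_of_ne_of_ne (Ne.symm hil) (Ne.symm hkl)]
          rw [s_braid i j l _ _ hil]
      by_cases hil : i = l
      · subst hil
        simp only [swap_apply_left, swap_apply_of_ne_of_ne (Ne.symm hik) (Ne.symm hjk)]
        rw [s_symm i j, s_symm k i, s_braid j i k _ _ hjk, s_symm k j]
      by_cases hjl : j = l
      · subst hjl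
        simp only [swap_apply_right, swap_apply_of_ne_of_ne (Ne.symm hik) (Ne.symm hjk)]
        rw [s_symm k j, s_braid i j k _ _ hik, s_symm k i]
      simp only [swap_apply_of_ne_of_ne (Ne.symm hik) (Ne.symm hjk),
        swap_apply_of_ne_of_ne (Ne.symm hil) (Ne.symm hjl)]
      exact s_comm i j k l _ _ hik hil hjk hjl)
    (by
      intro i j
      by_cases h : i = j
      · simp [h]
      · simp [h, Ne.symm h, s_symm i j])
  exact ⟨φ, fun i j h => by rw [hφ, dif_pos h]⟩

/-- The homomorphism `S_N → H_N` sending the transposition of `i` and `j` to `s i j`. It is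
unique because the transpositions generate `S_N`; it lets one regard permutations as elements
of `H_N`. -/
noncomputable def permHom (N : ℕ) : Perm (Fin N) →* H N := (exists_permHom N).choose

theorem permHom_swap {N : ℕ} (i j : Fin N) (h : i ≠ j) : permHom N (swap i j) = s i j h :=
  (exists_permHom N).choose_spec i j h

/-! ### The normal ordering map -/

/-- The linear map from polynomials in `N` commuting variables to an algebra `A` sending each
monomial to the corresponding product of powers of `a 0, …, a (N - 1)`, in this order. -/
noncomputable def orderedEval {N : ℕ} {A : Type*} [Ring A] [Algebra ℂ A] (a : Fin N → A) :
    MvPolynomial (Fin N) ℂ →ₗ[ℂ] A :=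
  (MvPolynomial.basisMonomials (Fin N) ℂ).constr ℂ
    fun m => (List.ofFn fun i => a i ^ m i).prod

/-- The algebra `ℂ[x] ⊗ ℂ[S_N] ⊗ ℂ[y]`, the source of the normal ordering map. -/
abbrev Source (N : ℕ) : Type :=
  (MvPolynomial (Fin N) ℂ ⊗[ℂ] MonoidAlgebra ℂ (Perm (Fin N))) ⊗[ℂ] MvPolynomial (Fin N) ℂ

/-- The normal ordering map `q ⊗ σ ⊗ p ↦ q(x) σ p(y)`. -/
noncomputable def normalOrder (N : ℕ) : Source N →ₗ[ℂ] H N :=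
  LinearMap.mul' ℂ (H N) ∘ₗ TensorProduct.map
    (LinearMap.mul' ℂ (H N) ∘ₗ TensorProduct.map (orderedEval x)
      (MonoidAlgebra.lift ℂ (H N) (Perm (Fin N)) (permHom N)).toLinearMap)
    (orderedEval y)

/-- The variable `x i` in the source of the normal ordering map. -/
noncomputable def srcX {N : ℕ} (i : Fin N) : Source N := (MvPolynomial.X i ⊗ₜ 1) ⊗ₜ 1

/-- The variable `y i` in the source of the normal ordering map. -/
noncomputable def srcY {N : ℕ} (i : Fin N) : Source N := (1 ⊗ₜ 1) ⊗ₜ MvPolynomial.X i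

/-! ### Polynomials in two central variables

Polynomials in the commuting variables `u`, `v` over a ring `A` that need not be commutative
are elements of `A[X][X]`, where the outer variable is `v` and the inner one is `u`. -/

/-- The variable `v`. -/
noncomputable def varV (A : Type*) [Ring A] : A[X][X] := X

/-- The variable `u`. -/
noncomputable def varU (A : Type*) [Ring A] : A[X][X] := C X

/-- The coefficientwise application of a linear map to a polynomial in `u` and `v`. -/
noncomputable def mapCoeff {A B : Type*} [Ring A] [Algebra ℂ A] [Ring B] [Algebra ℂ B]
    (f : A →ₗ[ℂ] B) (P : A[X][X]) : B[X][X] :=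
  P.sum fun m p => p.sum fun n a => monomial m (monomial n (f a))

theorem coeff_mapCoeff {A B : Type*} [Ring A] [Algebra ℂ A] [Ring B] [Algebra ℂ B]
    (f : A →ₗ[ℂ] B) (P : A[X][X]) (m n : ℕ) :
    ((mapCoeff f P).coeff m).coeff n = f ((P.coeff m).coeff n) := by
  simp only [mapCoeff, Polynomial.sum_def, finsetSum_coeff, coeff_monomial]
  rw [Finset.sum_eq_single m]
  · simp only [if_true, coeff_monomial]
    rw [Finset.sum_eq_single n]
    · simp
    · intro b _ hb; simp [hb]
    · intro hn; simp [notMem_support_iff.mp hn]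
  · intro b _ hb; simp [hb]
  · intro hm; simp [notMem_support_iff.mp hm]

/-! ### The universal central and spherical polynomials -/

/-- The universal central polynomial
`(-1)^N ∑ σ, :∏_{i, σ i = i} (1 - (v - x i) (u - y i)): sign σ • σ`, with coefficients
in `H_N`. -/
noncomputable def centralPolynomial (N : ℕ) : (H N)[X][X] :=
  (-1) ^ N * ∑ σ : Perm (Fin N),
    mapCoeff (normalOrder N) (List.ofFn fun i : Fin N =>
      if σ i = i then
        1 - (varV (Source N) - C (C (srcX i))) * (varU (Source N) - C (C (srcY i)))
      else 1).prod * C (C (Perm.sign σ • permHom N σ))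

/-- The element `c i j` of `H_N`: the coefficient of `v ^ (N - i) * u ^ (N - j)` in the universal
central polynomial. -/
noncomputable def c {N : ℕ} (i j : Fin (N + 1)) : H N :=
  ((centralPolynomial N).coeff (N - i)).coeff (N - j)

/-- The row determinant `∑ σ, sign σ • (a 0 (σ 0) * a 1 (σ 1) * ⋯)` of a square matrix over a
ring that need not be commutative. -/
noncomputable def rdet {A : Type*} [Ring A] {N : ℕ} (a : Matrix (Fin N) (Fin N) A) : A :=
  ∑ σ : Perm (Fin N), Perm.sign σ • (List.ofFn fun i => a i (σ i)).prod

/-- The symmetrizing element `e = (1 / N!) ∑ σ, σ` of `H_N`. -/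
noncomputable def e (N : ℕ) : H N :=
  ((N.factorial : ℂ)⁻¹) • ∑ σ : Perm (Fin N), permHom N σ

/-- The universal spherical polynomial `:rdet ((v - X) (u - Y) - K): e`, where `X` and `Y` are
the diagonal matrices of the `x i` and of the `y i`, and all entries of `K` are `1`. -/
noncomputable def sphericalPolynomial (N : ℕ) : (H N)[X][X] :=
  mapCoeff (normalOrder N) (rdet
    ((Matrix.scalar (Fin N) (varV (Source N)) - Matrix.diagonal fun i => C (C (srcX i))) *
        (Matrix.scalar (Fin N) (varU (Source N)) - Matrix.diagonal fun i => C (C (srcY i))) -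
      Matrix.of fun _ _ => 1)) * C (C (e N))

/-! ### The spherical subalgebra and the Satake homomorphism -/

theorem isIdempotentElem_e (N : ℕ) : IsIdempotentElem (e N) := by
  have h : ∀ σ : Perm (Fin N), permHom N σ * ∑ τ : Perm (Fin N), permHom N τ =
      ∑ τ : Perm (Fin N), permHom N τ := by
    intro σ
    rw [Finset.mul_sum]
    simp only [← map_mul]
    exact Equiv.sum_comp (Equiv.mulLeft σ) fun τ => permHom N τ
  have hN : (N.factorial : ℂ) ≠ 0 := by exact_mod_cast N.factorial_ne_zero
  rw [IsIdempotentElem, e, smul_mul_smul_comm, Finset.sum_mul]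
  simp only [h]
  rw [Finset.sum_const, Finset.card_univ, Fintype.card_perm, Fintype.card_fin,
    ← Nat.cast_smul_eq_nsmul ℂ, smul_smul]
  congr 1
  field_simp

/-- The spherical subalgebra `U_N = e H_N e` of `H_N`, a ring with identity `e`. -/
abbrev Spherical (N : ℕ) : Type := (isIdempotentElem_e N).Corner

/-- The structure of a `ℂ`-algebra on `U_N` inherited from `H_N`. -/
noncomputable instance sphericalAlgebra (N : ℕ) : Algebra ℂ (Spherical N) where
  smul r a := ⟨r • a.1, by
    obtain ⟨b, hb⟩ := a.2
    exact ⟨r • b, by simp only [mul_smul_comm, smul_mul_assoc, ← hb]⟩⟩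
  algebraMap :=
    { toFun := fun r => ⟨r • e N, r • 1, by
        simp only [mul_smul_comm, smul_mul_assoc, mul_one, (isIdempotentElem_e N).eq]⟩
      map_one' := Subtype.ext (one_smul ℂ (e N))
      map_mul' := fun r t => Subtype.ext (by
        change (r * t) • e N = (r • e N) * (t • e N)
        rw [smul_mul_smul_comm, (isIdempotentElem_e N).eq])
      map_zero' := Subtype.ext (zero_smul ℂ (e N))
      map_add' := fun r t => Subtype.ext (add_smul r t (e N)) }
  commutes' r a := Subtype.ext (by
    have h := (Subsemigroup.mem_corner_iff (isIdempotentElem_e N)).mp a.2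
    change (r • e N) * a.1 = a.1 * (r • e N)
    rw [smul_mul_assoc, mul_smul_comm, h.1, h.2])
  smul_def' r a := Subtype.ext (by
    have h := (Subsemigroup.mem_corner_iff (isIdempotentElem_e N)).mp a.2
    change r • a.1 = (r • e N) * a.1
    rw [smul_mul_assoc, h.1])

/-- The Satake homomorphism `z ↦ z e` from the center of `H_N` to `U_N`. -/
noncomputable def satake (N : ℕ) : Subalgebra.center ℂ (H N) →ₐ[ℂ] Spherical N where
  toFun z := ⟨z.1 * e N, z.1, by
    have h := (Subalgebra.mem_center_iff.mp z.2) (e N)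
    change e N * z.1 * e N = z.1 * e N
    rw [h, mul_assoc, (isIdempotentElem_e N).eq]⟩
  map_one' := Subtype.ext (one_mul (e N))
  map_mul' z w := Subtype.ext (by
    have h := (Subalgebra.mem_center_iff.mp w.2) (e N)
    change z.1 * w.1 * e N = (z.1 * e N) * (w.1 * e N)
    rw [mul_assoc z.1 (e N), ← mul_assoc (e N), h, mul_assoc w.1, (isIdempotentElem_e N).eq,
      mul_assoc])
  map_zero' := Subtype.ext (zero_mul (e N))
  map_add' z w := Subtype.ext (add_mul z.1 w.1 (e N))
  commutes' r := Subtype.ext (by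
    change algebraMap ℂ (H N) r * e N = r • e N
    rw [Algebra.smul_def])

end Cherednik

/-! Put a_i = v - x_i and b_i = u - y_i. Expanding the products over fixed points turns the
universal central polynomial into (-1)^N ∑_I (-1)^|I| a_I b_I A_J, where J is the complement of I,
a_I and b_I are products over I, and A_J is the antisymmetrizer of the permutations supported in J
(`centralPolynomial_eq`). Shifting by central variables changes no commutator, so the a_i, b_i again
satisfy the Cherednik relations, and these alone force the sum to commute with every b_k
(`Datum.commute_poly_b`). The anti-automorphism exchanging a and b gives the a_k. Hence all c_ij are
central. The spherical formula follows because σe = e, so each permutation may be inserted freely in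
front of e.

Injectivity of z ↦ ze: let S_K be the sum of the permutations supported in K. From z S_K = 0 one
deduces z S_{K∖k} = 0 and descends from the full index set to the empty one, where S = 1. Put w = z
S_{K∖k}, a = x_k and let b be the sum of the y_i with i outside K∖k. Both commute with w, and [a, b]
w = w, so commutation with b acts on polynomials in a, applied to w, as d/da. Since a is a root of
∏(T - x_i), which is monic with central coefficients, differentiating N times gives N! w = 0.

Surjectivity: it suffices that the c_ij e generate U_N. Under h ↦ ehe every A_J with |J| > 1 dies,
so the c_ij yield the sums over k of products of coefficients of ∏_{i≠k}(T - x_i) and ∏_{i≠k}(T -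
y_i), and from these the power sums ∑_k x_k^a y_k^b (`compress_sum_pow_mul_pow_mem`). These generate
by induction on the length of a word in the x_i, y_i and then on the number of indices in it
(`compress_wordProd_mem`): letters commute up to shorter words, and symmetrization expresses a word
through a power sum times a shorter word and words with fewer indices. -/

namespace Cherednik

open Equiv Polynomial
open scoped TensorProduct

/-! ### Sums over the permutations supported in a subset -/

section PermsOn

variable {N : ℕ}

/-- The permutations that fix every element outside `J`. -/
def permsOn (J : Finset (Fin N)) : Finset (Perm (Fin N)) :=
  Finset.univ.filter fun σ => ∀ i, i ∉ J → σ i = i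

theorem mem_permsOn {J : Finset (Fin N)} {σ : Perm (Fin N)} :
    σ ∈ permsOn J ↔ ∀ i, i ∉ J → σ i = i := by simp [permsOn]

theorem permsOn_empty : permsOn (∅ : Finset (Fin N)) = {1} := by
  ext σ
  simp only [mem_permsOn, Finset.notMem_empty, not_false_eq_true, forall_true_left,
    Finset.mem_singleton]
  exact ⟨fun h => Equiv.ext h, fun h i => by simp [h]⟩

theorem permsOn_univ : permsOn (Finset.univ : Finset (Fin N)) = Finset.univ := by
  ext σ
  simp [mem_permsOn]

theorem inv_mem_permsOn {J : Finset (Fin N)} {σ : Perm (Fin N)} (h : σ ∈ permsOn J) :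
    σ⁻¹ ∈ permsOn J := by
  rw [mem_permsOn] at *
  intro i hi
  rw [Perm.inv_eq_iff_eq, h i hi]

theorem apply_mem_of_mem_permsOn {J : Finset (Fin N)} {σ : Perm (Fin N)} (h : σ ∈ permsOn J)
    {k : Fin N} (hk : k ∈ J) : σ k ∈ J := by
  by_contra hn
  have h1 := σ.injective (mem_permsOn.mp h _ hn)
  exact hn (h1.symm ▸ hk)

variable {M : Type*} [AddCommMonoid M]

theorem sum_permsOn_inv (J : Finset (Fin N)) (f : Perm (Fin N) → M) :
    ∑ σ ∈ permsOn J, f σ⁻¹ = ∑ σ ∈ permsOn J, f σ :=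
  Finset.sum_bij' (fun σ _ => σ⁻¹) (fun σ _ => σ⁻¹) (fun _ h => inv_mem_permsOn h)
    (fun _ h => inv_mem_permsOn h) (fun _ _ => inv_inv _) (fun _ _ => inv_inv _) (fun _ _ => rfl)

/-- Coset decomposition: σ is determined by i = σ k and by τ = (i k)σ, which fixes k. -/
theorem sum_permsOn_eq_sum_erase {K : Finset (Fin N)} {k : Fin N} (hk : k ∈ K)
    (f : Perm (Fin N) → M) :
    ∑ σ ∈ permsOn K, f σ = ∑ i ∈ K, ∑ τ ∈ permsOn (K.erase k), f (swap i k * τ) := by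
  rw [← Finset.sum_product']
  have fixed : ∀ τ ∈ permsOn (K.erase k), τ k = k := fun τ h =>
    mem_permsOn.mp h k (Finset.notMem_erase k K)
  refine Finset.sum_bij' (fun σ _ => (σ k, swap (σ k) k * σ)) (fun q _ => swap q.1 k * q.2)
    ?_ ?_ ?_ ?_ ?_
  · intro σ h
    refine Finset.mem_product.mpr ⟨apply_mem_of_mem_permsOn h hk, ?_⟩
    rw [mem_permsOn]
    intro i hi
    by_cases hik : i = k
    · subst hik; simp
    · have hiK : i ∉ K := fun hh => hi (Finset.mem_erase.mpr ⟨hik, hh⟩)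
      have h1 := mem_permsOn.mp h i hiK
      rw [Perm.mul_apply, h1]
      exact swap_apply_of_ne_of_ne
        (fun hh => hiK (hh ▸ apply_mem_of_mem_permsOn h hk)) hik
  · rintro ⟨i, τ⟩ h
    obtain ⟨hi, hτ⟩ := Finset.mem_product.mp h
    rw [mem_permsOn]
    intro j hj
    have h1 := mem_permsOn.mp hτ j (fun hh => hj (Finset.mem_of_mem_erase hh))
    change swap i k (τ j) = j
    rw [h1]
    exact swap_apply_of_ne_of_ne (fun hh => hj (hh ▸ hi)) (fun hh => hj (hh ▸ hk))
  · intro σ h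
    simp
  · rintro ⟨i, τ⟩ h
    have h1 := fixed τ (Finset.mem_product.mp h).2
    simp [h1]
  · intro σ h
    simp

end PermsOn

/-! ### The Cherednik relations in an arbitrary ring -/

/-- Elements of a ring satisfying the relations of the rational Cherednik algebra. -/
structure Datum (N : ℕ) (R : Type*) [Ring R] where
  a : Fin N → R
  b : Fin N → R
  π : Perm (Fin N) →* R
  a_comm : ∀ i j, Commute (a i) (a j)
  b_comm : ∀ i j, Commute (b i) (b j)
  π_a : ∀ σ i, π σ * a i = a (σ i) * π σ
  π_b : ∀ σ i, π σ * b i = b (σ i) * π σ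
  ab : ∀ i j, i ≠ j → a i * b j = b j * a i + π (swap i j)
  ab_self : ∀ i, a i * b i = b i * a i - ∑ j ∈ Finset.univ.erase i, π (swap j i)

namespace Datum

variable {N : ℕ} {R : Type*} [Ring R] (D : Datum N R)

/-- The product of the `a i` with `i ∈ I`. -/
def aProd (I : Finset (Fin N)) : R := I.noncommProd D.a fun i _ j _ _ => D.a_comm i j

/-- The product of the `b i` with `i ∈ I`. -/
def bProd (I : Finset (Fin N)) : R := I.noncommProd D.b fun i _ j _ _ => D.b_comm i j

/-- The opposite datum, in which `a` and `b` are exchanged. -/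
def op : Datum N Rᵐᵒᵖ where
  a i := MulOpposite.op (D.b i)
  b i := MulOpposite.op (D.a i)
  π := { toFun := fun σ => MulOpposite.op (D.π σ⁻¹), map_one' := by simp,
         map_mul' := fun σ τ => by simp }
  a_comm i j := (D.b_comm i j).op
  b_comm i j := (D.a_comm i j).op
  π_a σ i := by
    change MulOpposite.op (D.b i * D.π σ⁻¹) = MulOpposite.op (D.π σ⁻¹ * D.b (σ i))
    rw [D.π_b]; simp
  π_b σ i := by
    change MulOpposite.op (D.a i * D.π σ⁻¹) = MulOpposite.op (D.π σ⁻¹ * D.a (σ i))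
    rw [D.π_a]; simp
  ab i j h := by
    change MulOpposite.op (D.a j * D.b i) =
      MulOpposite.op (D.b i * D.a j) + MulOpposite.op (D.π (swap i j)⁻¹)
    rw [D.ab j i h.symm, swap_inv, swap_comm, MulOpposite.op_add]
  ab_self i := by
    change MulOpposite.op (D.a i * D.b i) =
      MulOpposite.op (D.b i * D.a i) - ∑ j ∈ Finset.univ.erase i, MulOpposite.op (D.π (swap j i)⁻¹)
    rw [D.ab_self i, MulOpposite.op_sub, Finset.op_sum]
    simp

theorem aProd_insert {I : Finset (Fin N)} {i : Fin N} (h : i ∉ I) :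
    D.aProd (insert i I) = D.a i * D.aProd I :=
  Finset.noncommProd_insert_of_notMem _ _ _ _ h

theorem bProd_insert {I : Finset (Fin N)} {i : Fin N} (h : i ∉ I) :
    D.bProd (insert i I) = D.b i * D.bProd I :=
  Finset.noncommProd_insert_of_notMem _ _ _ _ h

@[simp] theorem aProd_empty : D.aProd ∅ = 1 := Finset.noncommProd_empty _ _

@[simp] theorem bProd_empty : D.bProd ∅ = 1 := Finset.noncommProd_empty _ _

theorem commute_aProd {r : R} (I : Finset (Fin N)) (h : ∀ i ∈ I, Commute r (D.a i)) :
    Commute r (D.aProd I) :=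
  Finset.noncommProd_commute _ _ _ _ h

theorem commute_bProd {r : R} (I : Finset (Fin N)) (h : ∀ i ∈ I, Commute r (D.b i)) :
    Commute r (D.bProd I) :=
  Finset.noncommProd_commute _ _ _ _ h

theorem op_aProd (I : Finset (Fin N)) : D.op.aProd I = MulOpposite.op (D.bProd I) := by
  induction I using Finset.induction_on with
  | empty => simp
  | insert i I hi ih =>
    rw [aProd_insert _ hi, bProd_insert _ hi, ih,
      (D.commute_bProd I fun j _ => D.b_comm i j).eq, MulOpposite.op_mul]
    rfl

theorem op_bProd (I : Finset (Fin N)) : D.op.bProd I = MulOpposite.op (D.aProd I) := by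
  induction I using Finset.induction_on with
  | empty => simp
  | insert i I hi ih =>
    rw [aProd_insert _ hi, bProd_insert _ hi, ih,
      (D.commute_aProd I fun j _ => D.a_comm i j).eq, MulOpposite.op_mul]
    rfl

/-! ### Antisymmetrizers -/

/-- The antisymmetrizer of the permutations supported in `J`. -/
def anti (J : Finset (Fin N)) : R := ∑ σ ∈ permsOn J, Perm.sign σ • D.π σ

theorem commute_π_a {σ : Perm (Fin N)} {k : Fin N} (h : σ k = k) : Commute (D.π σ) (D.a k) := by
  have := D.π_a σ k
  rwa [h] at this

theorem commute_π_b {σ : Perm (Fin N)} {k : Fin N} (h : σ k = k) : Commute (D.π σ) (D.b k) := by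
  have := D.π_b σ k
  rwa [h] at this

theorem commute_anti_a {J : Finset (Fin N)} {k : Fin N} (hk : k ∉ J) :
    Commute (D.anti J) (D.a k) :=
  Commute.sum_left _ _ _ fun _ hσ =>
    (D.commute_π_a (mem_permsOn.mp hσ k hk)).smul_left _

theorem commute_anti_b {J : Finset (Fin N)} {k : Fin N} (hk : k ∉ J) :
    Commute (D.anti J) (D.b k) :=
  Commute.sum_left _ _ _ fun _ hσ =>
    (D.commute_π_b (mem_permsOn.mp hσ k hk)).smul_left _

theorem op_anti (J : Finset (Fin N)) : D.op.anti J = MulOpposite.op (D.anti J) := by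
  rw [anti, anti, ← sum_permsOn_inv, Finset.op_sum]
  refine Finset.sum_congr rfl fun σ _ => ?_
  rw [Perm.sign_inv, MulOpposite.op_smul]
  change _ • MulOpposite.op (D.π σ⁻¹⁻¹) = _
  rw [inv_inv]

/-- In the coset decomposition of A_K the coset i = k contributes A_{K∖k}, and every other coset
acquires a sign from its transposition. -/
theorem anti_eq_sub {K : Finset (Fin N)} {k : Fin N} (hk : k ∈ K) :
    (∑ i ∈ K.erase k, D.π (swap i k)) * D.anti (K.erase k) = D.anti (K.erase k) - D.anti K := by
  rw [anti.eq_1 D K, sum_permsOn_eq_sum_erase hk, ← Finset.add_sum_erase _ _ hk]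
  have h1 : ∑ τ ∈ permsOn (K.erase k), Perm.sign (swap k k * τ) • D.π (swap k k * τ) =
      D.anti (K.erase k) := by
    simp only [swap_self, ← Perm.one_def, one_mul, anti]
  have h2 : ∀ i ∈ K.erase k,
      ∑ τ ∈ permsOn (K.erase k), Perm.sign (swap i k * τ) • D.π (swap i k * τ) =
      -(D.π (swap i k) * D.anti (K.erase k)) := by
    intro i hi
    rw [anti, Finset.mul_sum, ← Finset.sum_neg_distrib]
    refine Finset.sum_congr rfl fun τ _ => ?_
    rw [Perm.sign_mul, Perm.sign_swap (Finset.ne_of_mem_erase hi), map_mul, mul_smul_comm,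
      neg_one_mul, Units.neg_smul]
  rw [h1, Finset.sum_congr rfl h2, Finset.sum_neg_distrib, Finset.sum_mul]
  abel

theorem anti_eq_sub' {K : Finset (Fin N)} {k : Fin N} (hk : k ∈ K) :
    D.anti (K.erase k) * (∑ i ∈ K.erase k, D.π (swap i k)) = D.anti (K.erase k) - D.anti K := by
  have h := D.op.anti_eq_sub hk
  rw [op_anti, op_anti] at h
  have h2 : ∑ i ∈ K.erase k, D.op.π (swap i k) =
      MulOpposite.op (∑ i ∈ K.erase k, D.π (swap i k)) := by
    rw [Finset.op_sum]
    refine Finset.sum_congr rfl fun i _ => ?_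
    change MulOpposite.op (D.π (swap i k)⁻¹) = _
    rw [swap_inv]
  rw [h2, ← MulOpposite.op_mul, ← MulOpposite.op_sub] at h
  exact MulOpposite.op_injective h

theorem π_anti (τ : Perm (Fin N)) (J : Finset (Fin N)) :
    D.π τ * D.anti J = D.anti (J.map τ.toEmbedding) * D.π τ := by
  rw [anti, anti, Finset.mul_sum, Finset.sum_mul]
  refine Finset.sum_bij' (fun σ _ => τ * σ * τ⁻¹) (fun σ _ => τ⁻¹ * σ * τ) ?_ ?_ ?_ ?_ ?_
  · intro σ hσ
    rw [mem_permsOn] at *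
    intro i hi
    have : τ⁻¹ i ∉ J := by simpa using hi
    rw [Perm.mul_apply, Perm.mul_apply, hσ _ this, ← Perm.mul_apply, mul_inv_cancel, Perm.one_apply]
  · intro σ hσ
    rw [mem_permsOn] at *
    intro i hi
    have : τ i ∉ J.map τ.toEmbedding := by simpa using hi
    rw [Perm.mul_apply, Perm.mul_apply, hσ _ this, ← Perm.mul_apply, inv_mul_cancel, Perm.one_apply]
  · intro σ _; group
  · intro σ _; group
  · intro σ _
    rw [mul_smul_comm, smul_mul_assoc, ← map_mul, ← map_mul, inv_mul_cancel_right]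
    congr 1
    rw [Perm.sign_mul, Perm.sign_mul, Perm.sign_inv, mul_comm, ← mul_assoc, Int.units_mul_self,
      one_mul]

/-! ### Centrality from the Cherednik relations -/

/-- The central element `∑ I, (-1)^|I| a_I b_I A_{Iᶜ}`. -/
def poly : R := ∑ I : Finset (Fin N), (-1) ^ I.card * (D.aProd I * D.bProd I * D.anti Iᶜ)

/-- Reversal turns a_I b_I A into A a_I b_I; as A is supported off I, it commutes with both products
and returns to the right. -/
theorem op_poly : D.op.poly = MulOpposite.op D.poly := by
  rw [poly, poly, Finset.op_sum]
  refine Finset.sum_congr rfl fun I _ => ?_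
  have hA : Commute (D.anti Iᶜ) (D.aProd I) :=
    D.commute_aProd _ fun i hi => D.commute_anti_a (by simpa using hi)
  have hB : Commute (D.anti Iᶜ) (D.bProd I) :=
    D.commute_bProd _ fun i hi => D.commute_anti_b (by simpa using hi)
  rw [op_aProd, op_bProd, op_anti, ← MulOpposite.op_mul, ← MulOpposite.op_mul, ← mul_assoc,
    hA.eq, mul_assoc, hB.eq, ← mul_assoc]
  rw [MulOpposite.op_mul ((-1) ^ I.card), MulOpposite.op_pow, MulOpposite.op_neg,
    MulOpposite.op_one, ((Commute.neg_one_left _).pow_left _).eq]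

/-- Moving b_k past a_i leaves the transposition (i k), which commutes with the remaining factors
a_j since j ≠ i, k. -/
theorem aProd_mul_b {J : Finset (Fin N)} {k : Fin N} (hk : k ∉ J) :
    D.aProd J * D.b k = D.b k * D.aProd J + ∑ i ∈ J, D.aProd (J.erase i) * D.π (swap i k) := by
  induction J using Finset.induction_on with
  | empty => simp
  | insert j J hj ih =>
    have hkj : j ≠ k := fun h => hk (h ▸ Finset.mem_insert_self _ _)
    have hkJ : k ∉ J := fun h => hk (Finset.mem_insert_of_mem h)
    have hc : Commute (D.π (swap j k)) (D.aProd J) := D.commute_aProd J fun i hi =>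
      D.commute_π_a (swap_apply_of_ne_of_ne (fun h => hj (h ▸ hi)) (fun h => hkJ (h ▸ hi)))
    have hs : ∑ i ∈ J, D.aProd ((insert j J).erase i) * D.π (swap i k) =
        D.a j * ∑ i ∈ J, D.aProd (J.erase i) * D.π (swap i k) := by
      rw [Finset.mul_sum]
      refine Finset.sum_congr rfl fun i hi => ?_
      have hij : j ≠ i := fun h => hj (h ▸ hi)
      rw [Finset.erase_insert_of_ne hij, aProd_insert _
        (fun h => hj (Finset.mem_of_mem_erase h)), mul_assoc]
    rw [Finset.sum_insert hj, hs, Finset.erase_insert hj, aProd_insert _ hj, mul_assoc, ih hkJ,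
      mul_add, ← mul_assoc, D.ab j k hkj, add_mul, hc.eq]
    noncomm_ring

/-- The commutator of a_k with b_k produces minus all transpositions (i k). Those with i in J cancel
the terms from the other factors, because (i k) a_k = a_i (i k) restores the missing a_i. -/
theorem aProd_insert_mul_b {J : Finset (Fin N)} {k : Fin N} (hk : k ∉ J) :
    D.aProd (insert k J) * D.b k = D.b k * D.aProd (insert k J) -
      D.aProd J * ∑ i ∈ Jᶜ.erase k, D.π (swap i k) := by
  have hc : Commute (D.a k) (D.aProd J) := D.commute_aProd J fun i _ => D.a_comm k i
  have hs : (∑ i ∈ J, D.aProd (J.erase i) * D.π (swap i k)) * D.a k =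
      D.aProd J * ∑ i ∈ J, D.π (swap i k) := by
    rw [Finset.sum_mul, Finset.mul_sum]
    refine Finset.sum_congr rfl fun i hi => ?_
    rw [mul_assoc, D.π_a, swap_apply_right, ← mul_assoc]
    congr 1
    conv_rhs => rw [← Finset.insert_erase hi, aProd_insert _ (Finset.notMem_erase i J)]
    exact ((D.commute_aProd (J.erase i) fun j _ => D.a_comm i j).eq).symm
  have hu : ∑ i ∈ Finset.univ.erase k, D.π (swap i k) =
      ∑ i ∈ J, D.π (swap i k) + ∑ i ∈ Jᶜ.erase k, D.π (swap i k) := by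
    rw [← Finset.sum_union]
    · congr 1
      ext i
      simp only [Finset.mem_erase, Finset.mem_univ, and_true, Finset.mem_union, Finset.mem_compl]
      constructor
      · intro h; by_cases hi : i ∈ J <;> simp [h, hi]
      · rintro (h | h)
        · exact fun hh => hk (hh ▸ h)
        · exact h.1
    · rw [Finset.disjoint_left]
      intro i hi hi'
      simp [hi] at hi'
  rw [aProd_insert _ hk, hc.eq, mul_assoc, D.ab_self, mul_sub, ← mul_assoc,
    D.aProd_mul_b hk, add_mul, hs, hu]
  noncomm_ring

theorem commute_sum_swap_bProd (J : Finset (Fin N)) (k : Fin N) (hk : k ∉ J) :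
    Commute (∑ i ∈ Jᶜ.erase k, D.π (swap i k)) (D.bProd J) := by
  refine Commute.sum_left _ _ _ fun i hi => D.commute_bProd J fun j hj => D.commute_π_b ?_
  have hiJ : i ∉ J := Finset.mem_compl.mp (Finset.mem_of_mem_erase hi)
  exact swap_apply_of_ne_of_ne (fun h => hiJ (h ▸ hj)) (fun h => hk (h ▸ hj))

/-- Only a_{J∪k} fails to commute with b_k here; the transpositions it leaves are absorbed into the
antisymmetrizer by `anti_eq_sub`. -/
theorem commutator_term_insert {J : Finset (Fin N)} {k : Fin N} (hk : k ∉ J) :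
    D.aProd (insert k J) * D.bProd (insert k J) * D.anti (insert k J)ᶜ * D.b k -
      D.b k * (D.aProd (insert k J) * D.bProd (insert k J) * D.anti (insert k J)ᶜ) =
    -(D.aProd J * D.bProd J * (D.anti (Jᶜ.erase k) - D.anti Jᶜ) * D.b k) := by
  rw [Finset.compl_insert]
  have hA := (D.commute_anti_b (Finset.notMem_erase k Jᶜ)).eq
  have hB := (D.commute_bProd (insert k J) fun i _ => D.b_comm k i).eq
  have hB' := (D.commute_bProd J fun i _ => D.b_comm k i).eq
  have hS := (D.commute_sum_swap_bProd J k hk).eq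
  have hanti := D.anti_eq_sub (K := Jᶜ) (k := k) (by simpa using hk)
  have ha := D.aProd_insert_mul_b hk
  have h1 : D.aProd (insert k J) * D.bProd (insert k J) * D.anti (Jᶜ.erase k) * D.b k =
      D.aProd (insert k J) * D.b k * (D.bProd (insert k J) * D.anti (Jᶜ.erase k)) := by
    rw [mul_assoc _ _ (D.b k), hA]
    simp only [mul_assoc]
    rw [← mul_assoc _ (D.b k), ← hB, mul_assoc]
  have h2 : (∑ i ∈ Jᶜ.erase k, D.π (swap i k)) *
      (D.bProd (insert k J) * D.anti (Jᶜ.erase k)) =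
      D.bProd J * (D.anti (Jᶜ.erase k) - D.anti Jᶜ) * D.b k := by
    rw [← hanti, bProd_insert _ hk, hB', mul_assoc (D.bProd J), ← hA, ← mul_assoc, hS]
    simp only [mul_assoc]
  rw [h1, ha, sub_mul, mul_assoc (D.aProd J), h2]
  simp only [mul_assoc]
  abel

/-- The first summand is the failure of A to commute with b_k, as k lies in its support. In the
others, (i k) carries the factor b_i of b_J to b_k. -/
theorem commutator_term {J : Finset (Fin N)} {k : Fin N} (hk : k ∉ J) :
    D.aProd J * D.bProd J * D.anti Jᶜ * D.b k - D.b k * (D.aProd J * D.bProd J * D.anti Jᶜ) =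
    D.aProd J * D.bProd J * (D.anti Jᶜ * D.b k - D.b k * D.anti Jᶜ) +
      ∑ i ∈ J, D.aProd (J.erase i) * D.bProd (J.erase i) * D.b k *
        (D.π (swap i k) * D.anti Jᶜ) := by
  have hB' := (D.commute_bProd J fun i _ => D.b_comm k i).eq
  have ha : D.b k * D.aProd J = D.aProd J * D.b k -
      ∑ i ∈ J, D.aProd (J.erase i) * D.π (swap i k) := by
    rw [D.aProd_mul_b hk]; abel
  have hs : (∑ i ∈ J, D.aProd (J.erase i) * D.π (swap i k)) * (D.bProd J * D.anti Jᶜ) =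
      ∑ i ∈ J, D.aProd (J.erase i) * D.bProd (J.erase i) * D.b k *
        (D.π (swap i k) * D.anti Jᶜ) := by
    rw [Finset.sum_mul]
    refine Finset.sum_congr rfl fun i hi => ?_
    have hik : i ≠ k := fun h => hk (h ▸ hi)
    have h1 : D.π (swap i k) * D.bProd J = D.bProd (J.erase i) * D.b k * D.π (swap i k) := by
      conv_lhs => rw [← Finset.insert_erase hi, bProd_insert _ (Finset.notMem_erase i J)]
      have h2 : Commute (D.π (swap i k)) (D.bProd (J.erase i)) :=
        D.commute_bProd _ fun j hj => D.commute_π_b (swap_apply_of_ne_of_ne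
          (Finset.ne_of_mem_erase hj) (fun h => hk (h ▸ Finset.mem_of_mem_erase hj)))
      rw [← mul_assoc, D.π_b, swap_apply_left, mul_assoc, h2.eq, ← mul_assoc,
        (D.commute_bProd (J.erase i) fun j _ => D.b_comm k j).eq]
    rw [mul_assoc, ← mul_assoc (D.π _), h1]
    simp only [mul_assoc]
  have h0 : D.b k * (D.aProd J * D.bProd J * D.anti Jᶜ) =
      D.aProd J * D.bProd J * D.b k * D.anti Jᶜ -
      ∑ i ∈ J, D.aProd (J.erase i) * D.bProd (J.erase i) * D.b k *
        (D.π (swap i k) * D.anti Jᶜ) := by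
    rw [← hs, mul_assoc (D.aProd J) (D.bProd J) (D.anti _), ← mul_assoc, ha, sub_mul]
    congr 1
    rw [mul_assoc (D.aProd J), ← mul_assoc (D.b k), hB']
    simp only [mul_assoc]
  rw [h0]
  noncomm_ring

theorem sum_powerset_sum_erase {M : Type*} [AddCommMonoid M] (k : Fin N)
    (f : Finset (Fin N) → Fin N → M) :
    ∑ J ∈ (Finset.univ.erase k).powerset, ∑ i ∈ J, f J i =
      ∑ J ∈ (Finset.univ.erase k).powerset, ∑ i ∈ Jᶜ.erase k, f (insert i J) i := by
  rw [Finset.sum_sigma', Finset.sum_sigma']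
  refine Finset.sum_bij' (fun q _ => ⟨q.1.erase q.2, q.2⟩) (fun q _ => ⟨insert q.2 q.1, q.2⟩)
    ?_ ?_ ?_ ?_ ?_
  · rintro ⟨J, i⟩ h
    simp only [Finset.mem_sigma, Finset.mem_powerset] at h ⊢
    have := h.1 h.2
    refine ⟨(Finset.erase_subset _ _).trans h.1, ?_⟩
    simp at this ⊢
    exact this
  · rintro ⟨J, i⟩ h
    simp only [Finset.mem_sigma, Finset.mem_powerset, Finset.mem_erase, Finset.mem_compl] at h ⊢
    refine ⟨Finset.insert_subset (by simpa using h.2.1) h.1, Finset.mem_insert_self _ _⟩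
  · rintro ⟨J, i⟩ h
    simp only [Finset.mem_sigma] at h
    simp [Finset.insert_erase h.2]
  · rintro ⟨J, i⟩ h
    simp only [Finset.mem_sigma, Finset.mem_erase, Finset.mem_compl] at h
    simp [Finset.erase_insert h.2.2]
  · rintro ⟨J, i⟩ h
    simp only [Finset.mem_sigma] at h
    simp [Finset.insert_erase h.2]

/-- For each J without k, the terms of J and J ∪ {k} are grouped with the transposition terms of J ∪
{i}, i ∉ J ∪ {k}. With A = A_{Jᶜ} and A' = A_{Jᶜ∖k}, the group is ± a_J b_J times (A b_k - b_k A) +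
(A' - A) b_k - b_k (A' - A), which vanishes because A' commutes with b_k. -/
theorem commute_poly_b (k : Fin N) : Commute D.poly (D.b k) := by
  rw [commute_iff_eq, ← sub_eq_zero]
  set t : Finset (Fin N) → R := fun I => D.aProd I * D.bProd I * D.anti Iᶜ with ht
  have hn : ∀ (n : ℕ) (r s : R), r * ((-1) ^ n * s) = (-1) ^ n * (r * s) := fun n r s => by
    rw [← mul_assoc, ((Commute.neg_one_right r).pow_right n).eq, mul_assoc]
  have h0 : D.poly * D.b k - D.b k * D.poly =
      ∑ I : Finset (Fin N), (-1) ^ I.card * (t I * D.b k - D.b k * t I) := by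
    rw [poly, Finset.sum_mul, Finset.mul_sum, ← Finset.sum_sub_distrib]
    refine Finset.sum_congr rfl fun I _ => ?_
    rw [hn, mul_assoc, mul_sub]
  have hu : (Finset.univ : Finset (Finset (Fin N))) =
      (insert k (Finset.univ.erase k)).powerset := by
    rw [Finset.insert_erase (Finset.mem_univ k), Finset.powerset_univ]
  have hkJ : ∀ J ∈ (Finset.univ.erase k).powerset, k ∉ J := fun J hJ h => by
    simpa using (Finset.mem_powerset.mp hJ) h
  rw [h0, hu, Finset.sum_powerset_insert (Finset.notMem_erase _ _)]
  have h1 : ∀ J ∈ (Finset.univ.erase k).powerset,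
      (-1) ^ J.card * (t J * D.b k - D.b k * t J) =
      (-1) ^ J.card * (D.aProd J * D.bProd J * (D.anti Jᶜ * D.b k - D.b k * D.anti Jᶜ)) +
      ∑ i ∈ J, (-1) ^ J.card * (D.aProd (J.erase i) * D.bProd (J.erase i) * D.b k *
        (D.π (swap i k) * D.anti Jᶜ)) := fun J hJ => by
    rw [ht, D.commutator_term (hkJ J hJ), mul_add, Finset.mul_sum]
  have h2 : ∀ J ∈ (Finset.univ.erase k).powerset,
      (-1) ^ (insert k J).card * (t (insert k J) * D.b k - D.b k * t (insert k J)) =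
      (-1) ^ J.card * (D.aProd J * D.bProd J * (D.anti (Jᶜ.erase k) - D.anti Jᶜ) * D.b k) :=
    fun J hJ => by
    rw [ht, D.commutator_term_insert (hkJ J hJ), Finset.card_insert_of_notMem (hkJ J hJ), pow_succ]
    noncomm_ring
  have h3 : ∀ J ∈ (Finset.univ.erase k).powerset,
      ∑ i ∈ Jᶜ.erase k, (-1) ^ (insert i J).card *
        (D.aProd ((insert i J).erase i) * D.bProd ((insert i J).erase i) * D.b k *
        (D.π (swap i k) * D.anti (insert i J)ᶜ)) =
      -((-1) ^ J.card * (D.aProd J * D.bProd J * D.b k * (D.anti (Jᶜ.erase k) - D.anti Jᶜ))) := by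
    intro J hJ
    have hk : k ∈ Jᶜ := by simpa using hkJ J hJ
    rw [← D.anti_eq_sub' hk, Finset.mul_sum, Finset.mul_sum, Finset.mul_sum,
      ← Finset.sum_neg_distrib]
    refine Finset.sum_congr rfl fun i hi => ?_
    have hi' : i ∈ Jᶜ := Finset.mem_of_mem_erase hi
    have hiJ : i ∉ J := Finset.mem_compl.mp hi'
    -- Moving (i k) to the right of the antisymmetrizer conjugates its support, making it the same
    -- for all i; then `anti_eq_sub'` sums over i.
    have hmap : ((Jᶜ).erase i).map (swap i k).toEmbedding = Jᶜ.erase k := by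
      ext j
      rw [Finset.mem_map_equiv]
      simp only [symm_swap, Finset.mem_erase]
      by_cases hji : j = i
      · subst hji; simp [(Finset.ne_of_mem_erase hi).symm, hk, hi', Finset.ne_of_mem_erase hi]
      by_cases hjk : j = k
      · subst hjk; simp
      · rw [swap_apply_of_ne_of_ne hji hjk]; simp [hji, hjk]
    rw [Finset.card_insert_of_notMem hiJ, Finset.erase_insert hiJ, Finset.compl_insert, D.π_anti,
      hmap, pow_succ]
    noncomm_ring
  rw [Finset.sum_congr rfl h1, Finset.sum_congr rfl h2, Finset.sum_add_distrib,
    sum_powerset_sum_erase k (fun J i => (-1) ^ J.card *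
      (D.aProd (J.erase i) * D.bProd (J.erase i) * D.b k * (D.π (swap i k) * D.anti Jᶜ))),
    Finset.sum_congr rfl h3, ← Finset.sum_add_distrib, ← Finset.sum_add_distrib]
  refine Finset.sum_eq_zero fun J _ => ?_
  have hA := (D.commute_anti_b (Finset.notMem_erase k Jᶜ)).eq
  simp only [mul_sub, sub_mul, mul_assoc, hA]
  noncomm_ring

theorem commute_poly_a (k : Fin N) : Commute D.poly (D.a k) := by
  have h := D.op.commute_poly_b k
  rw [op_poly] at h
  exact MulOpposite.commute_op.mp h

end Datum

variable {N : ℕ}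

/-! ### The relations in `H_N` and in `H_N[u, v]` -/

theorem x_comm (i j : Fin N) : Commute (x i) (x j) := by
  by_cases h : i = j
  · rw [h]
  · have := mk_rel (Rel.x_comm i j h)
    rwa [map_mul, map_mul] at this

theorem y_comm (i j : Fin N) : Commute (y i) (y j) := by
  by_cases h : i = j
  · rw [h]
  · have := mk_rel (Rel.y_comm i j h)
    rwa [map_mul, map_mul] at this

theorem s_mul_x (i j k : Fin N) (h : i ≠ j) : s i j h * x k = x (swap i j k) * s i j h := by
  have key : ∀ (i j : Fin N) (h : i ≠ j), s i j h * x i = x j * s i j h := fun i j h => by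
    have := mk_rel (Rel.s_x i j h)
    rwa [map_mul, map_mul] at this
  by_cases hi : i = k
  · subst hi; rw [swap_apply_left]; exact key i j h
  by_cases hj : j = k
  · subst hj; rw [swap_apply_right, s_symm]; exact key j i _
  · rw [swap_apply_of_ne_of_ne (Ne.symm hi) (Ne.symm hj)]
    have := mk_rel (Rel.s_x_comm i j k h hi hj)
    rwa [map_mul, map_mul] at this

theorem s_mul_y (i j k : Fin N) (h : i ≠ j) : s i j h * y k = y (swap i j k) * s i j h := by
  have key : ∀ (i j : Fin N) (h : i ≠ j), s i j h * y i = y j * s i j h := fun i j h => by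
    have := mk_rel (Rel.s_y i j h)
    rwa [map_mul, map_mul] at this
  by_cases hi : i = k
  · subst hi; rw [swap_apply_left]; exact key i j h
  by_cases hj : j = k
  · subst hj; rw [swap_apply_right, s_symm]; exact key j i _
  · rw [swap_apply_of_ne_of_ne (Ne.symm hi) (Ne.symm hj)]
    have := mk_rel (Rel.s_y_comm i j k h hi hj)
    rwa [map_mul, map_mul] at this

theorem permHom_mul_x (σ : Perm (Fin N)) : ∀ k, permHom N σ * x k = x (σ k) * permHom N σ := by
  refine Perm.swap_induction_on σ (by simp) fun τ i j h ih k => ?_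
  rw [map_mul, mul_assoc, ih, ← mul_assoc, permHom_swap i j h, s_mul_x, mul_assoc]
  rfl

theorem permHom_mul_y (σ : Perm (Fin N)) : ∀ k, permHom N σ * y k = y (σ k) * permHom N σ := by
  refine Perm.swap_induction_on σ (by simp) fun τ i j h ih k => ?_
  rw [map_mul, mul_assoc, ih, ← mul_assoc, permHom_swap i j h, s_mul_y, mul_assoc]
  rfl

theorem x_mul_y_of_ne (i j : Fin N) (h : i ≠ j) :
    x i * y j = y j * x i + permHom N (swap i j) := by
  have := mk_rel (Rel.xy i j h)
  rw [map_sub, map_mul, map_mul] at this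
  rw [permHom_swap i j h, ← sub_eq_iff_eq_add']
  exact this

theorem x_mul_y_self (i : Fin N) :
    x i * y i = y i * x i - ∑ j ∈ Finset.univ.erase i, permHom N (swap j i) := by
  have := mk_rel (Rel.xy_self i)
  rw [map_sub, map_mul, map_mul, map_neg, map_sum] at this
  have h1 : ∑ j ∈ Finset.univ.erase i, permHom N (swap j i) =
      ∑ a : {a : Fin N // a ≠ i}, mk N (fs i a.1 a.2.symm) := by
    rw [Finset.sum_subtype (p := fun a => a ≠ i) _ (fun a => by simp)]
    refine Finset.sum_congr rfl fun a _ => ?_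
    rw [swap_comm, permHom_swap i a.1 a.2.symm]; rfl
  rw [h1, sub_eq_add_neg, ← this]
  change _ = y i * x i + (x i * y i - y i * x i)
  abel

/-- The tautological datum in `H_N`. -/
noncomputable def datum (N : ℕ) : Datum N (H N) where
  a := x
  b := y
  π := permHom N
  a_comm := x_comm
  b_comm := y_comm
  π_a := permHom_mul_x
  π_b := permHom_mul_y
  ab := x_mul_y_of_ne
  ab_self := x_mul_y_self

theorem commute_varV {A : Type*} [Ring A] (P : A[X][X]) : Commute (varV A) P := X_mul

theorem commute_varU {A : Type*} [Ring A] (P : A[X][X]) : Commute (varU A) P := by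
  ext m n
  simp [varU, X_mul]

/-- The constant polynomials, as a ring homomorphism. -/
noncomputable abbrev CC (A : Type*) [Ring A] : A →+* A[X][X] := C.comp C

theorem sub_mul_sub_eq_add {R : Type*} [Ring R] {V U a b z : R} (hVU : Commute V U)
    (hV : Commute V b) (hU : Commute U a) (h : a * b = b * a + z) :
    (V - a) * (U - b) = (U - b) * (V - a) + z := by
  simp only [mul_sub, sub_mul, hVU.eq, hV.eq, hU.eq, h]
  abel

/-- The datum `v - x i`, `u - y i` in `H_N[u, v]`. -/
noncomputable def polyDatum (N : ℕ) : Datum N (H N)[X][X] where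
  a i := varV (H N) - CC (H N) (x i)
  b i := varU (H N) - CC (H N) (y i)
  π := (CC (H N) : H N →* (H N)[X][X]).comp (permHom N)
  a_comm i j := by
    refine Commute.sub_left (commute_varV _) (Commute.sub_right (commute_varV _).symm ?_)
    exact (x_comm i j).map _
  b_comm i j := by
    refine Commute.sub_left (commute_varU _) (Commute.sub_right (commute_varU _).symm ?_)
    exact (y_comm i j).map _
  π_a σ i := by
    have h := congrArg (CC (H N)) (permHom_mul_x σ i)
    rw [map_mul, map_mul] at h
    rw [mul_sub, sub_mul, (commute_varV _).eq]
    exact congrArg _ h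
  π_b σ i := by
    have h := congrArg (CC (H N)) (permHom_mul_y σ i)
    rw [map_mul, map_mul] at h
    rw [mul_sub, sub_mul, (commute_varU _).eq]
    exact congrArg _ h
  ab i j hij := by
    refine sub_mul_sub_eq_add (commute_varV _) (commute_varV _) (commute_varU _) ?_
    have h := congrArg (CC (H N)) (x_mul_y_of_ne i j hij)
    rwa [map_mul, map_add, map_mul] at h
  ab_self i := by
    rw [sub_eq_add_neg _ (∑ j ∈ _, _)]
    refine sub_mul_sub_eq_add (commute_varV _) (commute_varV _) (commute_varU _) ?_
    have h := congrArg (CC (H N)) (x_mul_y_self i)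
    rwa [map_mul, map_sub, map_mul, map_sum, sub_eq_add_neg] at h

/-! ### Polynomials in the `x i` and in the `y i` -/

open scoped IsMulCommutative in
/-- Evaluation of polynomials at a commuting family. -/
theorem exists_evalCommuting {A : Type*} [Ring A] [Algebra ℂ A] (a : Fin N → A)
    (h : ∀ i j, Commute (a i) (a j)) :
    ∃ f : MvPolynomial (Fin N) ℂ →ₐ[ℂ] A, (∀ i, f (MvPolynomial.X i) = a i) ∧
      f.toLinearMap = orderedEval a := by
  -- `MvPolynomial.aeval` needs a commutative target, so evaluation passes through the subalgebra
  -- generated by the family.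
  have : IsMulCommutative (Algebra.adjoin ℂ (Set.range a)) :=
    Algebra.isMulCommutative_adjoin ℂ (by rintro _ ⟨i, rfl⟩ _ ⟨j, rfl⟩; exact h i j)
  let f : MvPolynomial (Fin N) ℂ →ₐ[ℂ] A := (Algebra.adjoin ℂ (Set.range a)).val.comp
    (MvPolynomial.aeval fun i => ⟨a i, Algebra.subset_adjoin ⟨i, rfl⟩⟩)
  have hf : ∀ i, f (MvPolynomial.X i) = a i := fun i => by
    simp [f]
  refine ⟨f, hf, (MvPolynomial.basisMonomials (Fin N) ℂ).ext fun m => ?_⟩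
  rw [orderedEval, Module.Basis.constr_basis, MvPolynomial.coe_basisMonomials,
    AlgHom.toLinearMap_apply]
  beta_reduce
  rw [MvPolynomial.monomial_eq, Finsupp.prod_fintype _ _ (by simp), map_one,
    one_mul, ← List.prod_ofFn, map_list_prod, List.map_ofFn]
  congr 2
  funext i
  simp [hf]

/-- The homomorphism `ℂ[x] → H_N`. -/
noncomputable def evalX (N : ℕ) : MvPolynomial (Fin N) ℂ →ₐ[ℂ] H N :=
  (exists_evalCommuting x x_comm).choose

/-- The homomorphism `ℂ[y] → H_N`. -/
noncomputable def evalY (N : ℕ) : MvPolynomial (Fin N) ℂ →ₐ[ℂ] H N :=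
  (exists_evalCommuting y y_comm).choose

@[simp] theorem evalX_X (i : Fin N) : evalX N (MvPolynomial.X i) = x i :=
  (exists_evalCommuting x x_comm).choose_spec.1 i

@[simp] theorem evalY_X (i : Fin N) : evalY N (MvPolynomial.X i) = y i :=
  (exists_evalCommuting y y_comm).choose_spec.1 i

theorem normalOrder_tmul (q p : MvPolynomial (Fin N) ℂ) (r : MonoidAlgebra ℂ (Perm (Fin N))) :
    normalOrder N ((q ⊗ₜ r) ⊗ₜ p) =
      evalX N q * MonoidAlgebra.lift ℂ (H N) (Perm (Fin N)) (permHom N) r * evalY N p := by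
  rw [normalOrder, ← (exists_evalCommuting x x_comm).choose_spec.2,
    ← (exists_evalCommuting y y_comm).choose_spec.2]
  rfl

/-- The polynomial `∏_{i ∈ I} (T - X i)`. -/
noncomputable def rootPoly (I : Finset (Fin N)) : (MvPolynomial (Fin N) ℂ)[X] :=
  ∏ i ∈ I, (X - C (MvPolynomial.X i))

/-- The polynomial `∏_{i ∈ I} (T - x i)`. -/
noncomputable def polyX (I : Finset (Fin N)) : (H N)[X] := (rootPoly I).map (evalX N : _ →+* H N)

/-- The polynomial `∏_{i ∈ I} (T - y i)`. -/
noncomputable def polyY (I : Finset (Fin N)) : (H N)[X] := (rootPoly I).map (evalY N : _ →+* H N)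

theorem polyDatum_aProd (I : Finset (Fin N)) :
    (polyDatum N).aProd I = (polyX I).map C := by
  induction I using Finset.induction_on with
  | empty => simp [polyX, rootPoly]
  | insert i I hi ih =>
    rw [Datum.aProd_insert _ hi, ih, polyX, polyX, rootPoly, rootPoly, Finset.prod_insert hi,
      Polynomial.map_mul, Polynomial.map_mul]
    congr 1
    simp [polyDatum, varV]

theorem polyDatum_bProd (I : Finset (Fin N)) :
    (polyDatum N).bProd I = C (polyY I) := by
  induction I using Finset.induction_on with
  | empty => simp [polyY, rootPoly]
  | insert i I hi ih =>
    rw [Datum.bProd_insert _ hi, ih, polyY, polyY, rootPoly, rootPoly, Finset.prod_insert hi,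
      Polynomial.map_mul, C_mul]
    congr 1
    simp [polyDatum, varU]

theorem coeff_aProd_mul_bProd (I J : Finset (Fin N)) (m n : ℕ) :
    (((polyDatum N).aProd I * (polyDatum N).bProd J).coeff m).coeff n =
      (polyX I).coeff m * (polyY J).coeff n := by
  rw [polyDatum_aProd, polyDatum_bProd, coeff_mul_C, coeff_map, coeff_C_mul]

/-! ### The normal ordering of products -/

/-- The inclusion of `ℂ[x] ⊗ ℂ[y]` into the source of the normal ordering map. -/
noncomputable def sourceIncl (N : ℕ) :
    MvPolynomial (Fin N) ℂ ⊗[ℂ] MvPolynomial (Fin N) ℂ →ₐ[ℂ] Source N :=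
  Algebra.TensorProduct.map Algebra.TensorProduct.includeLeft (AlgHom.id ℂ _)

theorem normalOrder_sourceIncl (q p : MvPolynomial (Fin N) ℂ) :
    normalOrder N (sourceIncl N (q ⊗ₜ p)) = evalX N q * evalY N p := by
  have : sourceIncl N (q ⊗ₜ p) = (q ⊗ₜ 1) ⊗ₜ p := rfl
  rw [this, normalOrder_tmul, map_one, mul_one]

section MapCoeff

variable {A B : Type*} [Ring A] [Algebra ℂ A] [Ring B] [Algebra ℂ B]

/-- The map `mapCoeff f` is additive. -/
noncomputable def mapCoeffHom (f : A →ₗ[ℂ] B) : A[X][X] →+ B[X][X] where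
  toFun := mapCoeff f
  map_zero' := by ext m n; simp [coeff_mapCoeff]
  map_add' P Q := by ext m n; simp [coeff_mapCoeff]

theorem map_neg_one_pow_mul {R S : Type*} [Ring R] [Ring S] (g : R →+ S) (n : ℕ) (r : R) :
    g ((-1) ^ n * r) = (-1) ^ n * g r := by
  induction n with
  | zero => simp
  | succ n ih =>
    rw [pow_succ', pow_succ', mul_assoc, mul_assoc, neg_one_mul, neg_one_mul, map_neg, ih]

theorem mapCoeffHom_neg_one_pow_mul (f : A →ₗ[ℂ] B) (n : ℕ) (P : A[X][X]) :
    mapCoeffHom f ((-1) ^ n * P) = (-1) ^ n * mapCoeffHom f P :=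
  map_neg_one_pow_mul (mapCoeffHom f) n P

end MapCoeff

/-! ### Expanding the universal polynomials -/

theorem prod_ofFn_neg {R : Type*} [Ring R] : ∀ {n : ℕ} (g : Fin n → R),
    (List.ofFn fun i => -g i).prod = (-1) ^ n * (List.ofFn g).prod
  | 0, _ => by simp
  | n + 1, g => by
    rw [List.ofFn_succ, List.ofFn_succ, List.prod_cons, List.prod_cons, prod_ofFn_neg, pow_succ',
      ← mul_assoc, ((Commute.neg_one_right (-g 0)).pow_right n).eq]
    simp only [mul_neg, neg_mul, one_mul, mul_assoc]

theorem permHom_mul_e (σ : Perm (Fin N)) : permHom N σ * e N = e N := by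
  rw [e, mul_smul_comm, Finset.mul_sum]
  simp only [← map_mul]
  exact congrArg _ (Equiv.sum_comp (Equiv.mulLeft σ) fun τ => permHom N τ)

theorem e_mul_permHom (σ : Perm (Fin N)) : e N * permHom N σ = e N := by
  rw [e, smul_mul_assoc, Finset.sum_mul]
  simp only [← map_mul]
  exact congrArg _ (Equiv.sum_comp (Equiv.mulRight σ) fun τ => permHom N τ)

/-- The product over the fixed points of `σ` entering the universal polynomials. -/
noncomputable def fixedProd {S : Type*} [Ring S] (a b : Fin N → S) (σ : Perm (Fin N)) : S[X][X] :=
  (List.ofFn fun i : Fin N => if σ i = i then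
    1 - (varV S - C (C (a i))) * (varU S - C (C (b i))) else 1).prod

/-- Off-diagonal entries are -1 and diagonal ones are minus the factor in `fixedProd`, so each row
yields one sign. -/
theorem rdet_eq_sum_fixedProd {S : Type*} [Ring S] (a b : Fin N → S) :
    rdet ((Matrix.scalar (Fin N) (varV S) - Matrix.diagonal fun i => C (C (a i))) *
        (Matrix.scalar (Fin N) (varU S) - Matrix.diagonal fun i => C (C (b i))) -
      Matrix.of fun _ _ => 1) = ∑ σ, Perm.sign σ • ((-1) ^ N * fixedProd a b σ) := by
  refine Finset.sum_congr rfl fun σ _ => congrArg _ ?_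
  rw [fixedProd, ← prod_ofFn_neg]
  congr 2
  funext i
  rw [Matrix.scalar_apply, Matrix.scalar_apply, Matrix.diagonal_sub, Matrix.diagonal_sub,
    Matrix.diagonal_mul_diagonal, Matrix.sub_apply, Matrix.diagonal_apply, Matrix.of_apply]
  by_cases h : σ i = i
  · rw [if_pos h, if_pos h.symm]; abel
  · rw [if_neg h, if_neg (Ne.symm h)]; abel

section NormalOrder

variable {T S : Type*} [CommRing T] [Algebra ℂ T] [Ring S] [Algebra ℂ S] (ι : T →ₐ[ℂ] S)
  (φ : S →ₗ[ℂ] H N) (qx qy : MvPolynomial (Fin N) ℂ →ₐ[ℂ] T)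

/-- The source of normal ordering contains the group algebra and need not be commutative. Factoring
through a commutative T lets finite products be rearranged before ordering. -/
theorem mapCoeff_prod (h : ∀ p q, φ (ι (qx p * qy q)) = evalX N p * evalY N q)
    (I : Finset (Fin N)) :
    mapCoeffHom φ (mapRingHom (mapRingHom (ι : T →+* S))
      ((∏ i ∈ I, (varV T - C (C (qx (MvPolynomial.X i))))) *
        ∏ i ∈ I, (varU T - C (C (qy (MvPolynomial.X i)))))) =
    (polyDatum N).aProd I * (polyDatum N).bProd I := by
  have h1 : ∏ i ∈ I, (varV T - C (C (qx (MvPolynomial.X i)))) =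
      ((rootPoly I).map (qx : _ →+* T)).map C := by
    simp [rootPoly, Polynomial.map_prod, varV]
  have h2 : ∏ i ∈ I, (varU T - C (C (qy (MvPolynomial.X i)))) =
      C ((rootPoly I).map (qy : _ →+* T)) := by
    simp [rootPoly, Polynomial.map_prod, varU, map_prod]
  rw [h1, h2]
  ext m n
  rw [coeff_aProd_mul_bProd]
  change ((mapCoeff _ _).coeff m).coeff n = _
  rw [coeff_mapCoeff, coe_mapRingHom, coeff_map, coe_mapRingHom, coeff_map, coeff_mul_C, coeff_map,
    coeff_C_mul, coeff_map, coeff_map, polyX, polyY, coeff_map, coeff_map]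
  exact h _ _

theorem mapCoeff_fixedProd (h : ∀ p q, φ (ι (qx p * qy q)) = evalX N p * evalY N q)
    (σ : Perm (Fin N)) :
    mapCoeffHom φ (fixedProd (fun i => ι (qx (MvPolynomial.X i)))
      (fun i => ι (qy (MvPolynomial.X i))) σ) =
      ∑ I ∈ (Finset.univ.filter fun i => σ i = i).powerset,
        (-1) ^ I.card * ((polyDatum N).aProd I * (polyDatum N).bProd I) := by
  have h1 : fixedProd (fun i => ι (qx (MvPolynomial.X i)))
      (fun i => ι (qy (MvPolynomial.X i))) σ = mapRingHom (mapRingHom (ι : T →+* S))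
      (∏ i : Fin N, if σ i = i then 1 + -((varV T - C (C (qx (MvPolynomial.X i)))) *
        (varU T - C (C (qy (MvPolynomial.X i))))) else 1) := by
    rw [← List.prod_ofFn, map_list_prod, List.map_ofFn, fixedProd]
    congr 2
    funext i
    simp only [Function.comp_apply]
    split_ifs
    · simp [varV, varU, sub_eq_add_neg]
    · simp
  rw [h1, ← Finset.prod_filter, Finset.prod_one_add, map_sum, map_sum]
  refine Finset.sum_congr rfl fun I _ => ?_
  have h2 := Finset.prod_neg (s := I) fun i => (varV T - C (C (qx (MvPolynomial.X i)))) *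
    (varU T - C (C (qy (MvPolynomial.X i))))
  refine (congrArg _ (congrArg _ h2)).trans ?_
  rw [Finset.prod_mul_distrib, map_mul, map_pow, map_neg, map_one,
    mapCoeffHom_neg_one_pow_mul, mapCoeff_prod ι φ qx qy h]

theorem mapCoeff_rdet (a b : Fin N → S) : mapCoeff φ (rdet
      ((Matrix.scalar (Fin N) (varV S) - Matrix.diagonal fun i => C (C (a i))) *
        (Matrix.scalar (Fin N) (varU S) - Matrix.diagonal fun i => C (C (b i))) -
      Matrix.of fun _ _ => 1)) * C (C (e N)) =
    (-1) ^ N * (∑ σ, mapCoeff φ (fixedProd a b σ) * C (C (Perm.sign σ • permHom N σ))) *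
      C (C (e N)) := by
  rw [rdet_eq_sum_fixedProd, mul_assoc, Finset.sum_mul]
  change mapCoeffHom _ _ * _ = _
  rw [map_sum, Finset.sum_mul, Finset.mul_sum]
  refine Finset.sum_congr rfl fun σ _ => ?_
  rw [Units.smul_def, map_zsmul, mapCoeffHom_neg_one_pow_mul, Units.smul_def, mul_assoc, ← C_mul,
    ← C_mul, smul_mul_assoc, smul_mul_assoc, permHom_mul_e, map_zsmul, map_zsmul, mul_smul_comm,
    mul_smul_comm, mul_assoc]
  rfl

end NormalOrder

theorem mapCoeff_normalOrder_fixedProd (σ : Perm (Fin N)) :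
    mapCoeff (normalOrder N) (List.ofFn fun i : Fin N =>
      if σ i = i then
        1 - (varV (Source N) - C (C (srcX i))) * (varU (Source N) - C (C (srcY i)))
      else 1).prod =
      ∑ I ∈ (Finset.univ.filter fun i => σ i = i).powerset,
        (-1) ^ I.card * ((polyDatum N).aProd I * (polyDatum N).bProd I) := by
  have h : ∀ p q : MvPolynomial (Fin N) ℂ, normalOrder N (sourceIncl N
      (Algebra.TensorProduct.includeLeft (R := ℂ) (S := ℂ) (B := MvPolynomial (Fin N) ℂ) p *
        Algebra.TensorProduct.includeRight (R := ℂ) (A := MvPolynomial (Fin N) ℂ) q)) =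
        evalX N p * evalY N q := fun p q => by
    rw [← normalOrder_sourceIncl, Algebra.TensorProduct.includeLeft_apply,
      Algebra.TensorProduct.includeRight_apply, Algebra.TensorProduct.tmul_mul_tmul, mul_one,
      one_mul]
  have h2 := mapCoeff_fixedProd (T := MvPolynomial (Fin N) ℂ ⊗[ℂ] MvPolynomial (Fin N) ℂ)
    (S := Source N) (sourceIncl N) (normalOrder N) Algebra.TensorProduct.includeLeft
    Algebra.TensorProduct.includeRight h σ
  rw [← h2]
  rfl

theorem centralPolynomial_eq : centralPolynomial N = (-1) ^ N * (polyDatum N).poly := by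
  have h1 : ∀ σ : Perm (Fin N), C (C (Perm.sign σ • permHom N σ)) =
      Perm.sign σ • (polyDatum N).π σ := fun σ => by
    rw [Units.smul_def, Units.smul_def, map_zsmul, map_zsmul]; rfl
  rw [centralPolynomial, Datum.poly]
  congr 1
  simp only [mapCoeff_normalOrder_fixedProd, h1, Finset.sum_mul]
  simp only [Datum.anti, Finset.mul_sum]
  -- The sums are exchanged: I consists of fixed points of σ exactly when σ is supported in the
  -- complement of I.
  refine Finset.sum_comm' (fun σ I => ?_) |>.trans (Finset.sum_congr rfl fun I _ =>
    Finset.sum_congr rfl fun σ _ => mul_assoc _ _ _)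
  simp only [Finset.mem_univ, true_and, mem_permsOn, Finset.mem_powerset, Finset.subset_iff,
    Finset.mem_filter, Finset.mem_compl, not_not, and_true]

theorem sphericalPolynomial_eq : sphericalPolynomial N = centralPolynomial N * C (C (e N)) := by
  have h := mapCoeff_rdet (S := Source N) (normalOrder N) srcX srcY
  rw [sphericalPolynomial, h]
  rfl

/-! ### Degrees and coefficients in `u` and `v` -/

theorem natDegree_rootPoly (I : Finset (Fin N)) : (rootPoly I).natDegree = I.card := by
  rw [rootPoly, natDegree_prod_of_monic _ _ fun _ _ => monic_X_sub_C _]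
  simp

theorem monic_rootPoly (I : Finset (Fin N)) : (rootPoly I).Monic :=
  monic_prod_of_monic _ _ fun _ _ => monic_X_sub_C _

theorem coeff_polyX_of_lt {I : Finset (Fin N)} {m : ℕ} (h : I.card < m) :
    (polyX I).coeff m = 0 := by
  rw [polyX, coeff_map, coeff_eq_zero_of_natDegree_lt (by rwa [natDegree_rootPoly]), map_zero]

theorem coeff_polyY_of_lt {I : Finset (Fin N)} {m : ℕ} (h : I.card < m) :
    (polyY I).coeff m = 0 := by
  rw [polyY, coeff_map, coeff_eq_zero_of_natDegree_lt (by rwa [natDegree_rootPoly]), map_zero]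

theorem coeff_polyX_card (I : Finset (Fin N)) : (polyX I).coeff I.card = 1 := by
  have := (monic_rootPoly I).coeff_natDegree
  rw [natDegree_rootPoly] at this
  rw [polyX, coeff_map, this, map_one]

theorem coeff_polyY_card (I : Finset (Fin N)) : (polyY I).coeff I.card = 1 := by
  have := (monic_rootPoly I).coeff_natDegree
  rw [natDegree_rootPoly] at this
  rw [polyY, coeff_map, this, map_one]

theorem polyDatum_anti (J : Finset (Fin N)) :
    (polyDatum N).anti J = C (C ((datum N).anti J)) := by
  rw [Datum.anti, Datum.anti, map_sum, map_sum]
  refine Finset.sum_congr rfl fun σ _ => ?_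
  rw [Units.smul_def, Units.smul_def, map_zsmul, map_zsmul]; rfl

theorem coeff_centralPolynomial (m n : ℕ) : ((centralPolynomial N).coeff m).coeff n =
    (-1) ^ N * ∑ I : Finset (Fin N),
      (-1) ^ I.card * ((polyX I).coeff m * (polyY I).coeff n * (datum N).anti Iᶜ) := by
  have h : ∀ k : ℕ, ((-1) ^ k : (H N)[X][X]) = C (C ((-1) ^ k)) := fun k => by simp
  rw [centralPolynomial_eq, Datum.poly, h, coeff_C_mul, coeff_C_mul, finsetSum_coeff,
    finsetSum_coeff]
  congr 1
  refine Finset.sum_congr rfl fun I _ => ?_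
  rw [h, coeff_C_mul, coeff_C_mul, polyDatum_anti, coeff_mul_C, coeff_mul_C,
    coeff_aProd_mul_bProd]

theorem coeff_centralPolynomial_eq_zero {m n : ℕ} (h : N < m ∨ N < n) :
    ((centralPolynomial N).coeff m).coeff n = 0 := by
  rw [coeff_centralPolynomial, Finset.sum_eq_zero, mul_zero]
  intro I _
  have hI : I.card ≤ N := by simpa using Finset.card_le_univ I
  rcases h with h | h
  · rw [coeff_polyX_of_lt (by omega)]; simp
  · rw [coeff_polyY_of_lt (by omega)]; simp

theorem c_rev {m n : ℕ} (hm : m ≤ N) (hn : n ≤ N) :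
    (c ⟨N - m, by omega⟩ ⟨N - n, by omega⟩ : H N) = ((centralPolynomial N).coeff m).coeff n := by
  rw [c]
  simp only
  rw [Nat.sub_sub_self hm, Nat.sub_sub_self hn]

theorem sphericalPolynomial_eq_sum : sphericalPolynomial N =
    ∑ i : Fin (N + 1), ∑ j : Fin (N + 1),
      monomial (N - i) (monomial (N - j) (c i j * e N)) := by
  rw [sphericalPolynomial_eq]
  ext m n
  rw [coeff_mul_C, coeff_mul_C]
  simp only [finsetSum_coeff, coeff_monomial]
  by_cases hm : m ≤ N
  · rw [Finset.sum_eq_single (⟨N - m, by omega⟩ : Fin (N + 1))]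
    · simp only [Nat.sub_sub_self hm, if_true, coeff_monomial]
      by_cases hn : n ≤ N
      · rw [Finset.sum_eq_single (⟨N - n, by omega⟩ : Fin (N + 1))]
        · simp only [Nat.sub_sub_self hn, if_true]
          rw [c_rev hm hn]
        · intro j _ hj
          rw [if_neg]
          intro h; apply hj; ext; simp only; omega
        · simp
      · rw [coeff_centralPolynomial_eq_zero (Or.inr (by omega)), zero_mul]
        refine (Finset.sum_eq_zero fun j _ => ?_).symm
        rw [if_neg (by omega)]
    · intro i _ hi
      refine Finset.sum_eq_zero fun j _ => ?_
      rw [if_neg, coeff_zero]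
      intro h; apply hi; ext; simp only; omega
    · simp
  · rw [coeff_centralPolynomial_eq_zero (Or.inl (by omega)), zero_mul]
    refine (Finset.sum_eq_zero fun i _ => Finset.sum_eq_zero fun j _ => ?_).symm
    rw [if_neg (by omega), coeff_zero]

/-! ### Centrality -/

theorem induction_generators {p : H N → Prop} (algebraMap : ∀ r, p (algebraMap ℂ (H N) r))
    (x : ∀ i, p (x i)) (y : ∀ i, p (y i)) (s : ∀ i j h, p (s i j h))
    (mul : ∀ a b, p a → p b → p (a * b)) (add : ∀ a b, p a → p b → p (a + b)) (h : H N) : p h := by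
  obtain ⟨f, rfl⟩ := RingQuot.mkAlgHom_surjective ℂ (Rel N) h
  change p (mk N f)
  induction f using FreeAlgebra.induction with
  | grade0 r => rw [AlgHom.commutes]; exact algebraMap r
  | grade1 g =>
    cases g with
    | x i => exact x i
    | y i => exact y i
    | s i j h => exact s i j h
  | mul a b ha hb => rw [map_mul]; exact mul _ _ ha hb
  | add a b ha hb => rw [map_add]; exact add _ _ ha hb

/-- The transpositions need no separate check, being the commutators [x_i, y_j]. -/
theorem mem_center_of_commute {z : H N} (hx : ∀ i, Commute z (x i)) (hy : ∀ i, Commute z (y i)) :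
    z ∈ Subalgebra.center ℂ (H N) := by
  rw [Subalgebra.mem_center_iff]
  intro h
  refine (induction_generators (p := fun h => Commute z h)
    (fun r => (Algebra.commutes r z).symm) hx hy (fun i j hij => ?_)
    (fun a b ha hb => ha.mul_right hb) (fun a b ha hb => ha.add_right hb) h).eq.symm
  rw [← permHom_swap, ← add_sub_cancel_left (y j * x i) (permHom N (swap i j)),
    ← x_mul_y_of_ne i j hij]
  exact ((hx i).mul_right (hy j)).sub_right ((hy j).mul_right (hx i))

theorem commute_coeff {P : (H N)[X][X]} {h : H N} (hP : Commute P (C (C h))) (m n : ℕ) :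
    Commute ((P.coeff m).coeff n) h := by
  have := congrArg (fun Q => (Q.coeff m).coeff n) hP.eq
  rwa [coeff_mul_C, coeff_mul_C, coeff_C_mul, coeff_C_mul] at this

theorem commute_neg_one_pow_mul {R : Type*} [Ring R] {P v z : R} (n : ℕ) (hv : Commute P v)
    (hz : Commute P (v - z)) : Commute ((-1) ^ n * P) z := by
  refine Commute.mul_left ((Commute.neg_one_left _).pow_left _) ?_
  have := hv.sub_right hz
  rwa [sub_sub_cancel] at this

theorem commute_centralPolynomial_x (i : Fin N) :
    Commute (centralPolynomial N) (C (C (x i))) := by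
  rw [centralPolynomial_eq]
  exact commute_neg_one_pow_mul N (commute_varV _).symm ((polyDatum N).commute_poly_a i)

theorem commute_centralPolynomial_y (i : Fin N) :
    Commute (centralPolynomial N) (C (C (y i))) := by
  rw [centralPolynomial_eq]
  exact commute_neg_one_pow_mul N (commute_varU _).symm ((polyDatum N).commute_poly_b i)

theorem coeff_centralPolynomial_mem_center (m n : ℕ) :
    ((centralPolynomial N).coeff m).coeff n ∈ Subalgebra.center ℂ (H N) := by
  refine mem_center_of_commute (fun i => commute_coeff ?_ m n) (fun i => commute_coeff ?_ m n)
  · exact commute_centralPolynomial_x i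
  · exact commute_centralPolynomial_y i

theorem c_mem_center (i j : Fin (N + 1)) : (c i j : H N) ∈ Subalgebra.center ℂ (H N) :=
  coeff_centralPolynomial_mem_center _ _

theorem compl_eq_empty_of_card_eq {I : Finset (Fin N)} (h : N ≤ I.card) : I = Finset.univ :=
  Finset.eq_univ_of_card I (le_antisymm (Finset.card_le_univ I) (by simpa using h))

theorem anti_empty : (datum N).anti ∅ = 1 := by
  simp [Datum.anti, permsOn_empty]

/-- The coefficients of `∏ i, (T - x i)` are central. -/
theorem coeff_polyX_eq (m : ℕ) : (polyX (Finset.univ : Finset (Fin N))).coeff m =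
    ((centralPolynomial N).coeff m).coeff N := by
  -- The power u^N occurs only for I the full index set, where its coefficient is 1 and the
  -- antisymmetrizer is trivial.
  rw [coeff_centralPolynomial, Finset.sum_eq_single Finset.univ]
  · have h := coeff_polyY_card (Finset.univ : Finset (Fin N))
    rw [Finset.card_univ, Fintype.card_fin] at h
    rw [Finset.card_univ, Fintype.card_fin, h, Finset.compl_univ, anti_empty, mul_one, mul_one,
      ← mul_assoc, ← pow_add, Even.neg_one_pow ⟨N, rfl⟩, one_mul]
  · intro I _ hI
    have : I.card < N := by
      by_contra h
      exact hI (compl_eq_empty_of_card_eq (by omega))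
    rw [coeff_polyY_of_lt this]; simp
  · simp

/-- The coefficients of `∏ i, (T - y i)` are central. -/
theorem coeff_polyY_eq (n : ℕ) : (polyY (Finset.univ : Finset (Fin N))).coeff n =
    ((centralPolynomial N).coeff N).coeff n := by
  rw [coeff_centralPolynomial, Finset.sum_eq_single Finset.univ]
  · have h := coeff_polyX_card (Finset.univ : Finset (Fin N))
    rw [Finset.card_univ, Fintype.card_fin] at h
    rw [Finset.card_univ, Fintype.card_fin, h, Finset.compl_univ, anti_empty, one_mul, mul_one,
      ← mul_assoc, ← pow_add, Even.neg_one_pow ⟨N, rfl⟩, one_mul]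
  · intro I _ hI
    have : I.card < N := by
      by_contra h
      exact hI (compl_eq_empty_of_card_eq (by omega))
    rw [coeff_polyX_of_lt this]; simp
  · simp

/-! ### Injectivity of the Satake homomorphism -/

section Weyl

variable {A : Type*} [Ring A] {a b w : A}

/-- As a commutes with w, [a, b] acts as 1 on every a^i w, and the Leibniz rule gives the Weyl
algebra formula. -/
theorem pow_commutator_mul (ha : Commute a w) (h : (a * b - b * a) * w = w) (n : ℕ) :
    (a ^ (n + 1) * b - b * a ^ (n + 1)) * w = (n + 1 : ℕ) * a ^ n * w := by
  induction n with
  | zero => simpa using h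
  | succ n ih =>
    have h1 : (a ^ (n + 2) * b - b * a ^ (n + 2)) * w =
        a ^ (n + 1) * ((a * b - b * a) * w) + (a ^ (n + 1) * b - b * a ^ (n + 1)) * (a * w) := by
      rw [pow_succ a (n + 1)]
      noncomm_ring
    rw [h1, h, ha.eq, ← mul_assoc, ih, mul_assoc (_ * _) w, ← ha.eq, ← mul_assoc, mul_assoc _ _ a,
      ← pow_succ, ← add_mul]
    push_cast
    noncomm_ring

variable [Algebra ℂ A]

theorem eval_commutator_mul (ha : Commute a w) (h : (a * b - b * a) * w = w) (q : A[X])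
    (hq : ∀ n, q.coeff n ∈ Subalgebra.center ℂ A) :
    (q.eval a * b - b * q.eval a) * w = q.derivative.eval a * w := by
  rw [eval_eq_sum, derivative_eval, Polynomial.sum_def, Polynomial.sum_def, Finset.sum_mul,
    Finset.mul_sum, ← Finset.sum_sub_distrib, Finset.sum_mul, Finset.sum_mul]
  refine Finset.sum_congr rfl fun n _ => ?_
  have hc := Subalgebra.mem_center_iff.mp (hq n) b
  rw [← mul_assoc b, hc, mul_assoc, mul_assoc, ← mul_sub, mul_assoc]
  cases n with
  | zero => simp
  | succ n =>
    rw [pow_commutator_mul ha h, Nat.add_sub_cancel]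
    simp only [mul_assoc]

/-- Commuting q(a)w = 0 with b gives q'(a)w = 0; repeating this leaves a nonzero scalar times w. -/
theorem eq_zero_of_eval_mul_eq_zero (ha : Commute a w) (hb : Commute b w)
    (h : (a * b - b * a) * w = w) (n : ℕ) : ∀ q : A[X],
    (∀ m, q.coeff m ∈ Subalgebra.center ℂ A) → q.natDegree ≤ n →
    (∃ r : ℂ, r ≠ 0 ∧ q.coeff n = algebraMap ℂ A r) → q.eval a * w = 0 → w = 0 := by
  induction n with
  | zero =>
    rintro q - hd ⟨r, hr, hqr⟩ hw
    rw [eq_C_of_natDegree_le_zero hd, eval_C, hqr, ← Algebra.smul_def] at hw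
    exact (smul_eq_zero.mp hw).resolve_left hr
  | succ n ih =>
    rintro q hq hd ⟨r, hr, hqr⟩ hw
    refine ih (derivative q) (fun m => ?_) ?_ ⟨r * (n + 1), ?_, ?_⟩ ?_
    · rw [coeff_derivative]
      refine mul_mem (hq _) ?_
      exact_mod_cast natCast_mem (Subalgebra.center ℂ A) (m + 1)
    · exact (natDegree_derivative_le q).trans (by omega)
    · exact mul_ne_zero hr (by exact_mod_cast Nat.succ_ne_zero n)
    · rw [coeff_derivative, hqr]; simp
    · rw [← eval_commutator_mul ha h q hq, sub_mul, mul_assoc, hb.eq, ← mul_assoc, hw,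
        mul_assoc b, hw]
      simp

end Weyl

/-- The sum of the permutations supported in `J`. -/
noncomputable def symSum (J : Finset (Fin N)) : H N := ∑ σ ∈ permsOn J, permHom N σ

theorem sum_swap_mul_symSum {K : Finset (Fin N)} {k : Fin N} (hk : k ∈ K) :
    (∑ i ∈ K.erase k, permHom N (swap i k)) * symSum (K.erase k) =
      symSum K - symSum (K.erase k) := by
  rw [symSum.eq_1 K, sum_permsOn_eq_sum_erase hk, ← Finset.add_sum_erase _ _ hk, Finset.sum_mul]
  simp only [symSum, Finset.mul_sum, swap_self, ← Perm.one_def, one_mul, map_mul]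
  abel

theorem commute_symSum_x {J : Finset (Fin N)} {k : Fin N} (hk : k ∉ J) :
    Commute (symSum J) (x k) :=
  Commute.sum_left _ _ _ fun _ hσ => (datum N).commute_π_a (mem_permsOn.mp hσ k hk)

theorem commute_symSum_y {J : Finset (Fin N)} {k : Fin N} (hk : k ∉ J) :
    Commute (symSum J) (y k) :=
  Commute.sum_left _ _ _ fun _ hσ => (datum N).commute_π_b (mem_permsOn.mp hσ k hk)

theorem eval_polyX_univ (k : Fin N) : (polyX Finset.univ).eval (x k) = 0 := by
  have h : (rootPoly (Finset.univ : Finset (Fin N))).eval (MvPolynomial.X k) = 0 := by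
    rw [rootPoly, eval_prod]
    exact Finset.prod_eq_zero (Finset.mem_univ k) (by simp)
  have h2 := hom_eval₂ (rootPoly (Finset.univ : Finset (Fin N))) (RingHom.id _)
    (evalX N : _ →+* H N) (MvPolynomial.X k)
  rw [RingHom.comp_id, eval₂_id, h, map_zero, RingHom.coe_coe, evalX_X] at h2
  rw [polyX, eval_map, ← h2]

/-- The y_i with i outside K are added to y_k precisely to cancel the transpositions (i k) with i
outside K. -/
theorem commutator_x_sum_y {K : Finset (Fin N)} {k : Fin N} (hk : k ∈ K) :
    x k * (∑ i ∈ (K.erase k)ᶜ, y i) - (∑ i ∈ (K.erase k)ᶜ, y i) * x k =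
      -∑ i ∈ K.erase k, permHom N (swap i k) := by
  have h1 : (K.erase k)ᶜ = insert k Kᶜ := Finset.compl_erase
  have hk' : k ∉ Kᶜ := by simpa using hk
  have h2 : x k * (∑ i ∈ Kᶜ, y i) - (∑ i ∈ Kᶜ, y i) * x k =
      ∑ i ∈ Kᶜ, permHom N (swap i k) := by
    rw [Finset.mul_sum, Finset.sum_mul, ← Finset.sum_sub_distrib]
    refine Finset.sum_congr rfl fun i hi => ?_
    rw [x_mul_y_of_ne k i (fun h => hk' (h ▸ hi)), swap_comm]
    abel
  have h3 : ∑ i ∈ Finset.univ.erase k, permHom N (swap i k) =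
      ∑ i ∈ K.erase k, permHom N (swap i k) + ∑ i ∈ Kᶜ, permHom N (swap i k) := by
    rw [← Finset.sum_union]
    · congr 1
      ext i
      simp only [Finset.mem_erase, Finset.mem_univ, and_true, Finset.mem_union, Finset.mem_compl]
      constructor
      · intro h; by_cases hi : i ∈ K <;> simp [h, hi]
      · rintro (h | h)
        · exact h.1
        · exact fun hh => h (hh ▸ hk)
    · rw [Finset.disjoint_left]
      intro i hi
      simp [Finset.mem_of_mem_erase hi]
  rw [h1, Finset.sum_insert hk', mul_add, add_mul, add_sub_add_comm, h2, x_mul_y_self, h3]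
  abel

/-- The coset decomposition gives [a, b] w = w - z S_K = w, so the derivative argument applies to
the equation of x_k. -/
theorem mul_symSum_erase_eq_zero {z : H N} (hz : z ∈ Subalgebra.center ℂ (H N))
    {K : Finset (Fin N)} {k : Fin N} (hk : k ∈ K) (h : z * symSum K = 0) :
    z * symSum (K.erase k) = 0 := by
  have hz' : ∀ h, Commute z h := fun h => (Subalgebra.mem_center_iff.mp hz h).symm
  have hx : Commute (x k) (z * symSum (K.erase k)) :=
    (hz' _).symm.mul_right (commute_symSum_x (Finset.notMem_erase k K)).symm
  have hy : Commute (∑ i ∈ (K.erase k)ᶜ, y i) (z * symSum (K.erase k)) :=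
    (hz' _).symm.mul_right (Commute.sum_left _ _ _ fun i hi =>
      (commute_symSum_y (Finset.mem_compl.mp hi)).symm)
  have hxy : (x k * (∑ i ∈ (K.erase k)ᶜ, y i) - (∑ i ∈ (K.erase k)ᶜ, y i) * x k) *
      (z * symSum (K.erase k)) = z * symSum (K.erase k) := by
    rw [commutator_x_sum_y hk, ← mul_assoc, ← (hz' _).eq, mul_assoc, neg_mul,
      sum_swap_mul_symSum hk, neg_sub, mul_sub, h, sub_zero]
  refine eq_zero_of_eval_mul_eq_zero hx hy hxy N (polyX Finset.univ) (fun m => ?_) ?_ ?_ ?_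
  · rw [coeff_polyX_eq]; exact coeff_centralPolynomial_mem_center _ _
  · refine natDegree_map_le.trans ?_
    rw [natDegree_rootPoly]; simp
  · refine ⟨1, one_ne_zero, ?_⟩
    have := coeff_polyX_card (Finset.univ : Finset (Fin N))
    rw [Finset.card_univ, Fintype.card_fin] at this
    rw [this, map_one]
  · rw [eval_polyX_univ, zero_mul]

theorem eq_zero_of_mul_symSum_eq_zero {z : H N} (hz : z ∈ Subalgebra.center ℂ (H N))
    (K : Finset (Fin N)) : z * symSum K = 0 → z = 0 := by
  induction K using Finset.induction_on with
  | empty =>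
    intro h
    simpa [symSum, permsOn_empty] using h
  | insert k K hk ih =>
    intro h
    refine ih ?_
    have := mul_symSum_erase_eq_zero hz (Finset.mem_insert_self k K) h
    rwa [Finset.erase_insert hk] at this

theorem satake_injective : Function.Injective (satake N) := by
  rw [injective_iff_map_eq_zero]
  rintro ⟨z, hz⟩ h
  have h1 : z * e N = 0 := congrArg Subtype.val h
  have h2 : z * symSum Finset.univ = 0 := by
    rw [e, mul_smul_comm] at h1
    have := (smul_eq_zero.mp h1).resolve_left
      (inv_ne_zero (by exact_mod_cast N.factorial_ne_zero))
    rwa [symSum, permsOn_univ]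
  exact Subtype.ext (eq_zero_of_mul_symSum_eq_zero hz _ h2)

/-! ### The compression `h ↦ e h e` -/

theorem commute_e {h : H N} (hh : ∀ σ, Commute (permHom N σ) h) : Commute (e N) h :=
  (Commute.sum_left _ _ _ fun σ _ => hh σ).smul_left _

/-- The linear map `h ↦ e h e` from `H_N` to `U_N`. -/
noncomputable def compress (N : ℕ) : H N →ₗ[ℂ] Spherical N where
  toFun h := ⟨e N * h * e N, h, rfl⟩
  map_add' a b := Subtype.ext (by
    change e N * (a + b) * e N = e N * a * e N + e N * b * e N
    rw [mul_add, add_mul])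
  map_smul' r a := Subtype.ext (by
    change e N * (r • a) * e N = r • (e N * a * e N)
    rw [mul_smul_comm, smul_mul_assoc])

theorem compress_val (h : H N) : (compress N h).1 = e N * h * e N := rfl

theorem compress_surjective : Function.Surjective (compress N) := by
  rintro ⟨a, h, rfl⟩
  exact ⟨h, rfl⟩

theorem compress_mul_left {a : H N} (ha : Commute (e N) a) (b : H N) :
    compress N (a * b) = compress N a * compress N b := Subtype.ext (by
  change e N * (a * b) * e N = (e N * a * e N) * (e N * b * e N)
  have he : ∀ r, e N * (e N * r) = e N * r := fun r => by
    rw [← mul_assoc, (isIdempotentElem_e N).eq]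
  have h : ∀ r, a * (e N * r) = e N * (a * r) := fun r => by
    rw [← mul_assoc, ← ha.eq, mul_assoc]
  simp only [mul_assoc, h, he])

theorem compress_mul_right {b : H N} (hb : Commute (e N) b) (a : H N) :
    compress N (a * b) = compress N a * compress N b := Subtype.ext (by
  change e N * (a * b) * e N = (e N * a * e N) * (e N * b * e N)
  have h : ∀ r, e N * (b * r) = b * (e N * r) := fun r => by
    rw [← mul_assoc, hb.eq, mul_assoc]
  simp only [mul_assoc, h, (isIdempotentElem_e N).eq])

theorem compress_one : compress N 1 = 1 := Subtype.ext (by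
  change e N * 1 * e N = e N
  rw [mul_one, (isIdempotentElem_e N).eq])

theorem compress_mul_permHom (h : H N) (σ : Perm (Fin N)) :
    compress N (h * permHom N σ) = compress N h := Subtype.ext (by
  rw [compress_val, compress_val, mul_assoc, mul_assoc, permHom_mul_e, mul_assoc])

theorem compress_permHom_mul (h : H N) (σ : Perm (Fin N)) :
    compress N (permHom N σ * h) = compress N h := Subtype.ext (by
  rw [compress_val, compress_val, ← mul_assoc, e_mul_permHom])

theorem commute_e_of_mem_center {z : H N} (hz : z ∈ Subalgebra.center ℂ (H N)) :
    Commute (e N) z := Subalgebra.mem_center_iff.mp hz (e N)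

theorem compress_eq_of_mem_center {z : H N} (hz : z ∈ Subalgebra.center ℂ (H N)) :
    (compress N z).1 = z * e N := by
  rw [compress_val, (commute_e_of_mem_center hz).eq, mul_assoc, (isIdempotentElem_e N).eq]

/-- The subalgebra of `U_N` generated by the elements `c i j * e`. -/
noncomputable def coeffAlgebra (N : ℕ) : Subalgebra ℂ (Spherical N) :=
  Algebra.adjoin ℂ {a : Spherical N | ∃ i j : Fin (N + 1), a.1 = c i j * e N}

theorem compress_c_mem (i j : Fin (N + 1)) : compress N (c i j) ∈ coeffAlgebra N :=
  Algebra.subset_adjoin ⟨i, j, compress_eq_of_mem_center (c_mem_center i j)⟩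

theorem compress_coeff_mem (m n : ℕ) :
    compress N (((centralPolynomial N).coeff m).coeff n) ∈ coeffAlgebra N := by
  by_cases h : m ≤ N ∧ n ≤ N
  · rw [← c_rev h.1 h.2]; exact compress_c_mem _ _
  · rw [coeff_centralPolynomial_eq_zero (by omega), map_zero]; exact zero_mem _

theorem compress_coeff_polyX_mem (m : ℕ) :
    compress N ((polyX Finset.univ).coeff m) ∈ coeffAlgebra N := by
  rw [coeff_polyX_eq]; exact compress_coeff_mem _ _

theorem compress_coeff_polyY_mem (n : ℕ) :
    compress N ((polyY Finset.univ).coeff n) ∈ coeffAlgebra N := by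
  rw [coeff_polyY_eq]; exact compress_coeff_mem _ _

/-! ### Polarized power sums -/

/-- Multiplied by e, the antisymmetrizer becomes a sum of signs, which cancels in pairs under a
transposition within J. -/
theorem compress_mul_anti_eq_zero {J : Finset (Fin N)} (hJ : 1 < J.card) (h : H N) :
    compress N (h * (datum N).anti J) = 0 := by
  have h1 : (datum N).anti J * e N = (∑ σ ∈ permsOn J, (Perm.sign σ : ℤ)) • e N := by
    rw [Datum.anti, Finset.sum_mul, Finset.sum_smul]
    refine Finset.sum_congr rfl fun σ _ => ?_
    rw [smul_mul_assoc, Units.smul_def]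
    exact congrArg _ (permHom_mul_e σ)
  obtain ⟨i, hi, j, hj, hij⟩ := Finset.one_lt_card.mp hJ
  have h2 : ∑ σ ∈ permsOn J, (Perm.sign σ : ℤ) = 0 := by
    refine Finset.sum_involution (fun σ _ => swap i j * σ) (fun σ _ => ?_) (fun σ _ _ hσ => ?_)
      (fun σ hσ => ?_) (fun σ _ => ?_)
    · simp [hij]
    · have := mul_eq_right.mp hσ
      exact hij (swap_eq_one_iff.mp this)
    · rw [mem_permsOn] at *
      intro k hk
      rw [Perm.mul_apply, hσ k hk]
      exact swap_apply_of_ne_of_ne (fun hh => hk (hh ▸ hi)) (fun hh => hk (hh ▸ hj))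
    · simp
  refine Subtype.ext ?_
  rw [compress_val, mul_assoc, mul_assoc, h1, h2, zero_smul, mul_zero, mul_zero]
  rfl

theorem anti_singleton (k : Fin N) : (datum N).anti {k} = 1 := by
  have : permsOn {k} = {1} := by
    ext σ
    rw [mem_permsOn, Finset.mem_singleton]
    refine ⟨fun h => ?_, fun h => by simp [h]⟩
    ext i
    by_cases hi : i = k
    · subst hi
      have h1 : σ i ∈ ({i} : Finset (Fin N)) :=
        apply_mem_of_mem_permsOn (mem_permsOn.mpr h) (Finset.mem_singleton_self i)
      rw [Finset.mem_singleton.mp h1, Perm.one_apply]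
    · rw [h i (by simpa using hi), Perm.one_apply]
  simp [Datum.anti, this]

theorem compress_coeff_centralPolynomial (m n : ℕ) :
    compress N (((centralPolynomial N).coeff m).coeff n) =
      compress N ((polyX Finset.univ).coeff m * (polyY Finset.univ).coeff n) -
      compress N (∑ k : Fin N, (polyX (Finset.univ.erase k)).coeff m *
        (polyY (Finset.univ.erase k)).coeff n) := by
  rw [coeff_centralPolynomial, ← Equiv.sum_comp (Function.Involutive.toPerm _
    -- Reindexing by J = Iᶜ makes the total sign (-1)^|J|; only the empty set and the singletons
    -- survive.
    (compl_involutive (α := Finset (Fin N)))), Finset.mul_sum]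
  have h1 : ∀ J : Finset (Fin N), (-1) ^ N * ((-1) ^ (Jᶜ).card *
      ((polyX Jᶜ).coeff m * (polyY Jᶜ).coeff n * (datum N).anti Jᶜᶜ)) =
      (-1) ^ J.card * ((polyX Jᶜ).coeff m * (polyY Jᶜ).coeff n * (datum N).anti J) := fun J => by
    have hJ : N = (Jᶜ).card + J.card := by
      rw [Finset.card_compl_add_card]; simp
    rw [← mul_assoc, compl_compl]
    congr 1
    rw [← pow_add, show N + (Jᶜ).card = 2 * (Jᶜ).card + J.card by omega, pow_add, pow_mul]
    simp
  simp only [Function.Involutive.coe_toPerm, h1]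
  rw [map_sum]
  have h2 : ∀ J : Finset (Fin N), 1 < J.card → compress N ((-1) ^ J.card *
      ((polyX Jᶜ).coeff m * (polyY Jᶜ).coeff n * (datum N).anti J)) = 0 := fun J hJ => by
    rw [← mul_assoc, compress_mul_anti_eq_zero hJ]
  rw [← Finset.sum_subset (Finset.subset_univ
    (insert ∅ (Finset.univ.image fun k : Fin N => ({k} : Finset (Fin N)))))]
  · rw [Finset.sum_insert (by simp [Finset.singleton_ne_empty]),
      Finset.sum_image (Finset.singleton_injective.injOn)]
    simp only [Finset.card_empty, Finset.card_singleton, anti_singleton, anti_empty, pow_zero,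
      pow_one, mul_one, one_mul, neg_mul, map_neg, Finset.sum_neg_distrib, Finset.compl_empty,
      map_sum, ← sub_eq_add_neg, Finset.compl_singleton]
  · intro J _ hJ
    refine h2 J ?_
    by_contra h
    apply hJ
    rcases Nat.le_one_iff_eq_zero_or_eq_one.mp (not_lt.mp h) with h | h
    · simp [Finset.card_eq_zero.mp h]
    · obtain ⟨k, rfl⟩ := Finset.card_eq_one.mp h
      simp

theorem commute_e_coeff_polyX (m : ℕ) : Commute (e N) ((polyX Finset.univ).coeff m) := by
  rw [coeff_polyX_eq]; exact commute_e_of_mem_center (coeff_centralPolynomial_mem_center _ _)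

theorem commute_e_coeff_polyY (n : ℕ) : Commute (e N) ((polyY Finset.univ).coeff n) := by
  rw [coeff_polyY_eq]; exact commute_e_of_mem_center (coeff_centralPolynomial_mem_center _ _)

theorem compress_sum_coeff_mem (m n : ℕ) :
    compress N (∑ k : Fin N, (polyX (Finset.univ.erase k)).coeff m *
        (polyY (Finset.univ.erase k)).coeff n) ∈ coeffAlgebra N := by
  have h := compress_coeff_centralPolynomial (N := N) m n
  rw [eq_sub_iff_add_eq, ← eq_sub_iff_add_eq'] at h
  rw [h, compress_mul_left (commute_e_coeff_polyX m)]
  exact sub_mem (mul_mem (compress_coeff_polyX_mem m) (compress_coeff_polyY_mem n))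
    (compress_coeff_mem _ _)

/-! ### From truncated products to power sums -/

theorem polyX_univ_eq (k : Fin N) :
    polyX Finset.univ = (X - C (x k)) * polyX (Finset.univ.erase k) := by
  rw [polyX, polyX, rootPoly, ← Finset.mul_prod_erase _ _ (Finset.mem_univ k), Polynomial.map_mul]
  congr 1
  simp

theorem polyY_univ_eq (k : Fin N) :
    polyY Finset.univ = (X - C (y k)) * polyY (Finset.univ.erase k) := by
  rw [polyY, polyY, rootPoly, ← Finset.mul_prod_erase _ _ (Finset.mem_univ k), Polynomial.map_mul]
  congr 1
  simp

theorem x_mul_coeff_succ (k : Fin N) (m : ℕ) :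
    x k * (polyX (Finset.univ.erase k)).coeff (m + 1) =
      (polyX (Finset.univ.erase k)).coeff m - (polyX Finset.univ).coeff (m + 1) := by
  rw [polyX_univ_eq k, sub_mul, coeff_sub, coeff_X_mul, coeff_C_mul, sub_sub_cancel]

theorem x_mul_coeff_zero (k : Fin N) :
    x k * (polyX (Finset.univ.erase k)).coeff 0 = -(polyX Finset.univ).coeff 0 := by
  rw [polyX_univ_eq k, sub_mul, coeff_sub, coeff_X_mul_zero, coeff_C_mul, zero_sub, neg_neg]

theorem y_mul_coeff_succ (k : Fin N) (m : ℕ) :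
    y k * (polyY (Finset.univ.erase k)).coeff (m + 1) =
      (polyY (Finset.univ.erase k)).coeff m - (polyY Finset.univ).coeff (m + 1) := by
  rw [polyY_univ_eq k, sub_mul, coeff_sub, coeff_X_mul, coeff_C_mul, sub_sub_cancel]

theorem y_mul_coeff_zero (k : Fin N) :
    y k * (polyY (Finset.univ.erase k)).coeff 0 = -(polyY Finset.univ).coeff 0 := by
  rw [polyY_univ_eq k, sub_mul, coeff_sub, coeff_X_mul_zero, coeff_C_mul, zero_sub, neg_neg]

theorem coeff_polyX_erase_top (k : Fin N) : (polyX (Finset.univ.erase k)).coeff (N - 1) = 1 := by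
  have := coeff_polyX_card (Finset.univ.erase k)
  rwa [Finset.card_erase_of_mem (Finset.mem_univ k), Finset.card_univ, Fintype.card_fin] at this

theorem coeff_polyY_erase_top (k : Fin N) : (polyY (Finset.univ.erase k)).coeff (N - 1) = 1 := by
  have := coeff_polyY_card (Finset.univ.erase k)
  rwa [Finset.card_erase_of_mem (Finset.mem_univ k), Finset.card_univ, Fintype.card_fin] at this

theorem coeff_polyX_mem_center (m : ℕ) :
    (polyX Finset.univ).coeff m ∈ Subalgebra.center ℂ (H N) := by
  rw [coeff_polyX_eq]; exact coeff_centralPolynomial_mem_center _ _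

/-- Comparing coefficients in P = (T - x_k) P_k trades a factor x_k for a lower coefficient of P_k,
up to a coefficient of P, which is central and factors out. -/
theorem compress_sum_pow_mul_coeff_mem (a : ℕ) : ∀ m n : ℕ,
    compress N (∑ k : Fin N, x k ^ a * (polyX (Finset.univ.erase k)).coeff m *
        (polyY (Finset.univ.erase k)).coeff n) ∈ coeffAlgebra N := by
  induction a with
  | zero => intro m n; simpa using compress_sum_coeff_mem m n
  | succ a ih =>
    intro m n
    have h0 : ∀ n, compress N (∑ k : Fin N, x k ^ a *
        (polyY (Finset.univ.erase k)).coeff n) ∈ coeffAlgebra N := fun n => by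
      -- The coefficient of index N - 1 is the leading one, equal to 1.
      simpa [coeff_polyX_erase_top] using ih (N - 1) n
    have h1 : ∀ m, compress N (∑ k : Fin N, x k ^ a * (polyX Finset.univ).coeff m *
        (polyY (Finset.univ.erase k)).coeff n) ∈ coeffAlgebra N := fun m => by
      have h2 : ∀ k : Fin N, x k ^ a * (polyX Finset.univ).coeff m *
          (polyY (Finset.univ.erase k)).coeff n = (polyX Finset.univ).coeff m *
            (x k ^ a * (polyY (Finset.univ.erase k)).coeff n) := fun k => by
        rw [Subalgebra.mem_center_iff.mp (coeff_polyX_mem_center m), mul_assoc]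
      rw [Finset.sum_congr rfl fun k _ => h2 k, ← Finset.mul_sum,
        compress_mul_left (commute_e_coeff_polyX m)]
      exact mul_mem (compress_coeff_polyX_mem m) (h0 n)
    cases m with
    | zero =>
      simp only [pow_succ, mul_assoc (x _ ^ a) (x _), x_mul_coeff_zero, mul_neg, neg_mul,
        Finset.sum_neg_distrib, map_neg]
      exact neg_mem (h1 0)
    | succ m =>
      simp only [pow_succ, mul_assoc (x _ ^ a) (x _), x_mul_coeff_succ, mul_sub, sub_mul,
        Finset.sum_sub_distrib, map_sub]
      exact sub_mem (ih m n) (h1 (m + 1))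

theorem compress_sum_pow_mul_pow_mul_coeff_mem (a b : ℕ) : ∀ n : ℕ,
    compress N (∑ k : Fin N, x k ^ a * (y k ^ b * (polyY (Finset.univ.erase k)).coeff n)) ∈
      coeffAlgebra N := by
  induction b with
  | zero =>
    intro n
    simpa [coeff_polyX_erase_top] using compress_sum_pow_mul_coeff_mem (N := N) a (N - 1) n
  | succ b ih =>
    intro n
    have h0 : compress N (∑ k : Fin N, x k ^ a * y k ^ b) ∈ coeffAlgebra N := by
      simpa [coeff_polyY_erase_top] using ih (N - 1)
    have h1 : ∀ n, compress N (∑ k : Fin N, x k ^ a * (y k ^ b * (polyY Finset.univ).coeff n)) ∈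
        coeffAlgebra N := fun n => by
      simp only [← mul_assoc]
      rw [← Finset.sum_mul, compress_mul_right (commute_e_coeff_polyY n)]
      exact mul_mem h0 (compress_coeff_polyY_mem n)
    cases n with
    | zero =>
      simp only [pow_succ, mul_assoc (y _ ^ b) (y _), y_mul_coeff_zero, mul_neg,
        Finset.sum_neg_distrib, map_neg]
      exact neg_mem (h1 0)
    | succ n =>
      simp only [pow_succ, mul_assoc (y _ ^ b) (y _), y_mul_coeff_succ, mul_sub,
        Finset.sum_sub_distrib, map_sub]
      exact sub_mem (ih n) (h1 (n + 1))

theorem compress_sum_pow_mul_pow_mem (a b : ℕ) :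
    compress N (∑ k : Fin N, x k ^ a * y k ^ b) ∈ coeffAlgebra N := by
  simpa [coeff_polyY_erase_top] using compress_sum_pow_mul_pow_mul_coeff_mem (N := N) a b (N - 1)

/-! ### Words in the generators `x i` and `y i` -/

/-- The generator `x i` or `y i` named by a letter. -/
noncomputable def letter : Fin N ⊕ Fin N → H N := Sum.elim x y

/-- The index of a letter. -/
def letterIndex : Fin N ⊕ Fin N → Fin N := Sum.elim id id

/-- The product of the letters of a word. -/
noncomputable def wordProd (l : List (Fin N ⊕ Fin N)) : H N := (l.map letter).prod

theorem wordProd_cons (a : Fin N ⊕ Fin N) (l : List (Fin N ⊕ Fin N)) :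
    wordProd (a :: l) = letter a * wordProd l := by simp [wordProd]

theorem wordProd_append (l l' : List (Fin N ⊕ Fin N)) :
    wordProd (l ++ l') = wordProd l * wordProd l' := by simp [wordProd]

/-- The action of a permutation on letters. -/
def permLetter (σ : Perm (Fin N)) : Fin N ⊕ Fin N → Fin N ⊕ Fin N := Sum.map σ σ

theorem permHom_mul_wordProd (σ : Perm (Fin N)) (l : List (Fin N ⊕ Fin N)) :
    permHom N σ * wordProd l = wordProd (l.map (permLetter σ)) * permHom N σ := by
  induction l with
  | nil => simp [wordProd]
  | cons a l ih =>
    have h : permHom N σ * letter a = letter (permLetter σ a) * permHom N σ := by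
      cases a with
      | inl i => exact permHom_mul_x σ i
      | inr i => exact permHom_mul_y σ i
    rw [List.map_cons, wordProd_cons, wordProd_cons, ← mul_assoc, h, mul_assoc, ih, mul_assoc]

/-- The span of the elements `w σ` where `w` is a word of length at most `d`. -/
noncomputable def wordSpan (N d : ℕ) : Submodule ℂ (H N) :=
  Submodule.span ℂ {h | ∃ (l : List (Fin N ⊕ Fin N)) (σ : Perm (Fin N)),
    l.length ≤ d ∧ h = wordProd l * permHom N σ}

theorem wordProd_mul_permHom_mem {d : ℕ} {l : List (Fin N ⊕ Fin N)} (hl : l.length ≤ d)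
    (σ : Perm (Fin N)) : wordProd l * permHom N σ ∈ wordSpan N d :=
  Submodule.subset_span ⟨l, σ, hl, rfl⟩

theorem wordProd_mem {d : ℕ} {l : List (Fin N ⊕ Fin N)} (hl : l.length ≤ d) :
    wordProd l ∈ wordSpan N d := by
  simpa using wordProd_mul_permHom_mem hl 1

theorem wordSpan_mono {d d' : ℕ} (h : d ≤ d') : wordSpan N d ≤ wordSpan N d' :=
  Submodule.span_mono fun _ ⟨l, σ, hl, hh⟩ => ⟨l, σ, hl.trans h, hh⟩

theorem letter_mul_mem {d : ℕ} (a : Fin N ⊕ Fin N) {h : H N} (hh : h ∈ wordSpan N d) :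
    letter a * h ∈ wordSpan N (d + 1) := by
  induction hh using Submodule.span_induction with
  | mem h hm =>
    obtain ⟨l, σ, hl, rfl⟩ := hm
    rw [← mul_assoc, ← wordProd_cons]
    exact wordProd_mul_permHom_mem (by simpa using hl) σ
  | zero => rw [mul_zero]; exact zero_mem _
  | add u v _ _ hu hv => rw [mul_add]; exact add_mem hu hv
  | smul r u _ hu => rw [mul_smul_comm]; exact Submodule.smul_mem _ _ hu

theorem permHom_mul_mem {d : ℕ} (τ : Perm (Fin N)) {h : H N} (hh : h ∈ wordSpan N d) :
    permHom N τ * h ∈ wordSpan N d := by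
  induction hh using Submodule.span_induction with
  | mem h hm =>
    obtain ⟨l, σ, hl, rfl⟩ := hm
    rw [← mul_assoc, permHom_mul_wordProd, mul_assoc, ← map_mul]
    exact wordProd_mul_permHom_mem (by simpa using hl) _
  | zero => rw [mul_zero]; exact zero_mem _
  | add u v _ _ hu hv => rw [mul_add]; exact add_mem hu hv
  | smul r u _ hu => rw [mul_smul_comm]; exact Submodule.smul_mem _ _ hu

theorem exists_mem_wordSpan (h : H N) : ∃ d, h ∈ wordSpan N d := by
  suffices ∀ (d : ℕ) (g : H N), g ∈ wordSpan N d → ∃ d', h * g ∈ wordSpan N d' by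
    have h1 : (1 : H N) ∈ wordSpan N 0 := by
      simpa [wordProd] using wordProd_mem (N := N) (l := []) (le_refl 0)
    simpa using this 0 1 h1
  refine induction_generators (p := fun h => ∀ (d : ℕ) (g : H N), g ∈ wordSpan N d →
    ∃ d', h * g ∈ wordSpan N d') ?_ ?_ ?_ ?_ ?_ ?_ h
  · intro r d g hg
    exact ⟨d, by rw [← Algebra.smul_def]; exact Submodule.smul_mem _ _ hg⟩
  · exact fun i d g hg => ⟨d + 1, letter_mul_mem (Sum.inl i) hg⟩
  · exact fun i d g hg => ⟨d + 1, letter_mul_mem (Sum.inr i) hg⟩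
  · exact fun i j hij d g hg => ⟨d, by rw [← permHom_swap]; exact permHom_mul_mem _ hg⟩
  · intro a b ha hb d g hg
    obtain ⟨d', hd'⟩ := hb d g hg
    obtain ⟨d'', hd''⟩ := ha d' _ hd'
    exact ⟨d'', by rwa [mul_assoc]⟩
  · intro a b ha hb d g hg
    obtain ⟨d', hd'⟩ := hb d g hg
    obtain ⟨d'', hd''⟩ := ha d _ hg
    refine ⟨max d' d'', ?_⟩
    rw [add_mul]
    exact add_mem (wordSpan_mono (le_max_right _ _) hd'') (wordSpan_mono (le_max_left _ _) hd')

theorem x_commutator_y_mul_mem {d : ℕ} (i j : Fin N) {h : H N} (hh : h ∈ wordSpan N d) :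
    (x i * y j - y j * x i) * h ∈ wordSpan N d := by
  by_cases hij : i = j
  · subst hij
    rw [x_mul_y_self, sub_sub_cancel_left, neg_mul, Finset.sum_mul]
    exact neg_mem (sum_mem fun j _ => permHom_mul_mem _ hh)
  · rw [x_mul_y_of_ne i j hij, add_sub_cancel_left]
    exact permHom_mul_mem _ hh

theorem letter_commutator_mul_mem {d : ℕ} (a b : Fin N ⊕ Fin N) {h : H N}
    (hh : h ∈ wordSpan N d) : (letter a * letter b - letter b * letter a) * h ∈ wordSpan N d := by
  rcases a with i | i <;> rcases b with j | j
  · have : letter (Sum.inl i) * letter (Sum.inl j) = letter (Sum.inl j) * letter (Sum.inl i) :=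
      (x_comm i j).eq
    rw [this, sub_self, zero_mul]; exact zero_mem _
  · exact x_commutator_y_mul_mem i j hh
  · rw [← neg_sub, neg_mul]; exact neg_mem (x_commutator_y_mul_mem j i hh)
  · have : letter (Sum.inr i) * letter (Sum.inr j) = letter (Sum.inr j) * letter (Sum.inr i) :=
      (y_comm i j).eq
    rw [this, sub_self, zero_mul]; exact zero_mem _

theorem wordProd_sub_mem_of_perm {l l' : List (Fin N ⊕ Fin N)} (h : l.Perm l') :
    wordProd l - wordProd l' ∈ wordSpan N (l.length - 1) := by
  induction h with
  | nil => rw [sub_self]; exact zero_mem _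
  | @cons a l l' hl ih =>
    rw [wordProd_cons, wordProd_cons, ← mul_sub]
    -- Truncated subtraction: for an empty tail the length bound is not recovered by adding 1, but
    -- the difference is zero.
    by_cases h0 : l.length = 0
    · have h1 : l = [] := List.length_eq_zero_iff.mp h0
      subst h1
      rw [List.nil_perm.mp hl, sub_self, mul_zero]
      exact zero_mem _
    · have := letter_mul_mem a ih
      rwa [List.length_cons, Nat.add_sub_cancel, ← Nat.sub_add_cancel (Nat.pos_of_ne_zero h0)]
  | swap a b l =>
    rw [wordProd_cons, wordProd_cons, wordProd_cons, wordProd_cons, ← mul_assoc, ← mul_assoc,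
      ← sub_mul]
    exact letter_commutator_mul_mem _ _ (wordProd_mem (by simp))
  | trans h1 _ ih1 ih2 =>
    rw [← h1.length_eq] at ih2
    have := add_mem ih1 ih2
    rwa [sub_add_sub_cancel] at this

/-- The set of indices occurring in a word. -/
def wordSupport (l : List (Fin N ⊕ Fin N)) : Finset (Fin N) := (l.map letterIndex).toFinset

/-- The word `(x j)^a (y j)^b`. -/
def powWord (a b : ℕ) (j : Fin N) : List (Fin N ⊕ Fin N) :=
  List.replicate a (Sum.inl j) ++ List.replicate b (Sum.inr j)

theorem wordProd_powWord (a b : ℕ) (j : Fin N) : wordProd (powWord a b j) = x j ^ a * y j ^ b := by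
  simp [powWord, wordProd, letter]

theorem exists_perm_powWord_append (k : Fin N) (l : List (Fin N ⊕ Fin N)) :
    ∃ a b l', l.Perm (powWord a b k ++ l') ∧ k ∉ wordSupport l' := by
  induction l with
  | nil => exact ⟨0, 0, [], by simp [powWord], by simp [wordSupport]⟩
  | cons c l ih =>
    obtain ⟨a, b, l', hl, hk⟩ := ih
    by_cases hc : letterIndex c = k
    · rcases c with i | i
      · obtain rfl : i = k := hc
        exact ⟨a + 1, b, l', by simpa [powWord, List.replicate_succ] using hl, hk⟩
      · obtain rfl : i = k := hc
        refine ⟨a, b + 1, l', (hl.cons _).trans ?_, hk⟩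
        simp only [powWord, List.replicate_succ, List.append_assoc, List.cons_append]
        exact List.perm_middle.symm
    · refine ⟨a, b, c :: l', (hl.cons _).trans List.perm_middle.symm, ?_⟩
      simp only [wordSupport, List.map_cons, List.toFinset_cons, Finset.mem_insert, not_or] at hk ⊢
      exact ⟨Ne.symm hc, hk⟩

/-! ### Generation by power sums -/

theorem compress_wordSpan_le {d : ℕ}
    (h : ∀ l : List (Fin N ⊕ Fin N), l.length ≤ d → compress N (wordProd l) ∈ coeffAlgebra N)
    {g : H N} (hg : g ∈ wordSpan N d) : compress N g ∈ coeffAlgebra N := by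
  induction hg using Submodule.span_induction with
  | mem g hm =>
    obtain ⟨l, σ, hl, rfl⟩ := hm
    rw [compress_mul_permHom]
    exact h l hl
  | zero => rw [map_zero]; exact zero_mem _
  | add u v _ _ hu hv => rw [map_add]; exact add_mem hu hv
  | smul r u _ hu => rw [map_smul]; exact Subalgebra.smul_mem _ hu _

theorem wordSupport_append (l l' : List (Fin N ⊕ Fin N)) :
    wordSupport (l ++ l') = wordSupport l ∪ wordSupport l' := by
  simp [wordSupport]

theorem wordSupport_powWord_subset (a b : ℕ) (j : Fin N) : wordSupport (powWord a b j) ⊆ {j} := by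
  intro i hi
  simp only [wordSupport, powWord, List.map_append, List.map_replicate, List.mem_toFinset,
    List.mem_append, List.mem_replicate] at hi
  rw [Finset.mem_singleton]
  rcases hi with ⟨-, h⟩ | ⟨-, h⟩ <;> exact h

/-- Conjugation by (j k) fixes the tail and exchanges the heads, and e absorbs permutations on
either side. -/
theorem compress_powWord_append_eq (a b : ℕ) {j k : Fin N} {l : List (Fin N ⊕ Fin N)}
    (hj : j ∉ wordSupport l) (hk : k ∉ wordSupport l) :
    compress N (wordProd (powWord a b j ++ l)) = compress N (wordProd (powWord a b k ++ l)) := by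
  have h := permHom_mul_wordProd (swap j k) (powWord a b j ++ l)
  have h1 : (powWord a b j ++ l).map (permLetter (swap j k)) = powWord a b k ++ l := by
    rw [List.map_append]
    congr 1
    · simp [powWord, permLetter]
    · conv_rhs => rw [← List.map_id l]
      refine List.map_congr_left fun c hc => ?_
      have hs : letterIndex c ∈ wordSupport l := by
        rw [wordSupport, List.mem_toFinset]; exact List.mem_map_of_mem hc
      have hfix : swap j k (letterIndex c) = letterIndex c :=
        swap_apply_of_ne_of_ne (fun hh => hj (hh ▸ hs)) (fun hh => hk (hh ▸ hs))
      rcases c with i | i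
      · exact congrArg Sum.inl hfix
      · exact congrArg Sum.inr hfix
  rw [h1] at h
  rw [← compress_permHom_mul _ (swap j k), h, compress_mul_permHom]

theorem commute_e_powerSum (a b : ℕ) : Commute (e N) (∑ k : Fin N, x k ^ a * y k ^ b) := by
  refine commute_e fun σ => ?_
  rw [commute_iff_eq, Finset.mul_sum, Finset.sum_mul,
    ← Equiv.sum_comp σ fun k => x k ^ a * y k ^ b * permHom N σ]
  refine Finset.sum_congr rfl fun k _ => ?_
  have hx : SemiconjBy (permHom N σ) (x k) (x (σ k)) := permHom_mul_x σ k
  have hy : SemiconjBy (permHom N σ) (y k) (y (σ k)) := permHom_mul_y σ k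
  exact ((hx.pow_right a).mul_right (hy.pow_right b)).eq

theorem compress_wordProd_mem (d : ℕ) : ∀ l : List (Fin N ⊕ Fin N), l.length = d →
    compress N (wordProd l) ∈ coeffAlgebra N := by
  induction d using Nat.strong_induction_on with
  | _ d ihd =>
  suffices ∀ (r : ℕ) (l : List (Fin N ⊕ Fin N)), (wordSupport l).card = r → l.length = d →
      compress N (wordProd l) ∈ coeffAlgebra N from fun l hl => this _ l rfl hl
  intro r
  induction r using Nat.strong_induction_on with
  | _ r ihr =>
  rintro l hr hd
  rcases l with _ | ⟨c₀, t⟩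
  · rw [wordProd, List.map_nil, List.prod_nil, compress_one]; exact one_mem _
  set l := c₀ :: t with hl
  set k := letterIndex c₀ with hk
  have hkl : k ∈ wordSupport l := by simp [wordSupport, hl, hk]
  obtain ⟨a, b, l', hp, hkl'⟩ := exists_perm_powWord_append k l
  have hsupp : wordSupport l = wordSupport (powWord a b k) ∪ wordSupport l' := by
    rw [← wordSupport_append]
    exact List.toFinset_eq_of_perm _ _ (hp.map _)
  have hlen : ∀ j, (powWord a b j ++ l').length = d := fun j => by
    rw [← hd, hp.length_eq]; simp [powWord]
  have hdpos : 0 < d := by rw [← hd, hl]; simp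
  have hlt : l'.length < d := by
    have hab : powWord a b k ≠ [] := by
      intro h0
      rw [hsupp, h0] at hkl
      simp [wordSupport] at hkl hkl'
      exact absurd hkl (by simpa using hkl')
    have := hlen k
    rw [List.length_append] at this
    have := List.length_pos_iff.mpr hab
    omega
  have hcard : (wordSupport l').card < r := by
    rw [← hr]
    refine Finset.card_lt_card ⟨?_, fun h => hkl' (h hkl)⟩
    rw [hsupp]; exact Finset.subset_union_right
  have hdiff : compress N (wordProd l) - compress N (wordProd (powWord a b k ++ l')) ∈
      coeffAlgebra N := by
    rw [← map_sub]
    refine compress_wordSpan_le (fun l'' hl'' => ihd _ ?_ l'' rfl) (wordProd_sub_mem_of_perm hp)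
    omega
  -- The sum over j is a symmetric power sum times a shorter word. Terms with j in the support of
  -- `l'` involve fewer indices; the others all equal the term of k, so one divides by their number,
  -- nonzero because k is among them.
  have hsum : ∑ j : Fin N, compress N (wordProd (powWord a b j ++ l')) ∈ coeffAlgebra N := by
    have h1 : ∑ j : Fin N, compress N (wordProd (powWord a b j ++ l')) =
        compress N (∑ j : Fin N, x j ^ a * y j ^ b) * compress N (wordProd l') := by
      rw [← compress_mul_left (commute_e_powerSum a b), Finset.sum_mul, map_sum]
      simp only [wordProd_append, wordProd_powWord]
    rw [h1]
    exact mul_mem (compress_sum_pow_mul_pow_mem a b) (ihd _ hlt l' rfl)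
  rw [← Finset.sum_filter_add_sum_filter_not _ (fun j => j ∈ wordSupport l')] at hsum
  have hin : ∑ j ∈ Finset.univ.filter (fun j => j ∈ wordSupport l'),
      compress N (wordProd (powWord a b j ++ l')) ∈ coeffAlgebra N := by
    refine sum_mem fun j hj => ihr _ ?_ _ rfl (hlen j)
    refine lt_of_le_of_lt (Finset.card_le_card ?_) hcard
    rw [wordSupport_append]
    exact Finset.union_subset ((wordSupport_powWord_subset a b j).trans
      (by simpa using hj)) subset_rfl
  rw [add_mem_cancel_left hin, Finset.sum_congr rfl (fun j hj => compress_powWord_append_eq a b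
    (Finset.mem_filter.mp hj).2 hkl'), Finset.sum_const, ← Nat.cast_smul_eq_nsmul ℂ] at hsum
  have hne : ((Finset.univ.filter fun j => j ∉ wordSupport l').card : ℂ) ≠ 0 := by
    rw [Nat.cast_ne_zero]
    exact (Finset.card_pos.mpr ⟨k, by simpa using hkl'⟩).ne'
  have hmem := Subalgebra.smul_mem _ hsum
    (((Finset.univ.filter fun j => j ∉ wordSupport l').card : ℂ)⁻¹)
  rw [smul_smul, inv_mul_cancel₀ hne, one_smul] at hmem
  simpa using add_mem hdiff hmem

theorem coeffAlgebra_eq_top : coeffAlgebra N = ⊤ := by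
  rw [eq_top_iff]
  rintro u -
  obtain ⟨h, rfl⟩ := compress_surjective u
  obtain ⟨d, hd⟩ := exists_mem_wordSpan h
  exact compress_wordSpan_le (fun l _ => compress_wordProd_mem _ l rfl) hd

/-- The image contains the generators c_ij e, since the c_ij are central. -/
theorem satake_surjective : Function.Surjective (satake N) := by
  rw [← AlgHom.range_eq_top, eq_top_iff, ← coeffAlgebra_eq_top, coeffAlgebra, Algebra.adjoin_le_iff]
  rintro u ⟨i, j, hu⟩
  exact ⟨⟨c i j, c_mem_center i j⟩, Subtype.ext hu.symm⟩

end Cherednik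

theorem theorem3p5 (N : ℕ) :
    (Cherednik.sphericalPolynomial N =
      ∑ i : Fin (N + 1), ∑ j : Fin (N + 1),
        Polynomial.monomial (N - i) (Polynomial.monomial (N - j)
          (Cherednik.c i j * Cherednik.e N))) ∧
    (∀ i j : Fin (N + 1), ∃ h : Cherednik.H N,
      Cherednik.c i j * Cherednik.e N = Cherednik.e N * h * Cherednik.e N) ∧
    Algebra.adjoin ℂ {a : Cherednik.Spherical N |
      ∃ i j : Fin (N + 1), a.1 = Cherednik.c i j * Cherednik.e N} = ⊤ ∧
    (∀ z : Subalgebra.center ℂ (Cherednik.H N),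
      (Cherednik.satake N z).1 = z.1 * Cherednik.e N) ∧
    Function.Bijective (Cherednik.satake N) :=
  ⟨Cherednik.sphericalPolynomial_eq_sum,
    fun i j => ⟨Cherednik.c i j,
      (Cherednik.compress_eq_of_mem_center (Cherednik.c_mem_center i j)).symm⟩,
    Cherednik.coeffAlgebra_eq_top, fun _ => rfl,
    Cherednik.satake_injective, Cherednik.satake_surjective⟩
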